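/- Let $\|x\|$ denote the distance from the real number $x$ to the nearest integer. For an irrational number $\alpha$ with continued fraction expansion $\alpha=[a_0;a_1,a_2,\dots]$ and convergents $p_k/q_k=[a_0;a_1,\dots,a_k]$ in lowest terms with $q_k\ge 1$, put $s_K=\sum_{k=1}^K a_k$; and write $\log^* x=\log\max\{e,x\}$. For every constant $c>0$ there is a constant $C$, depending only on $c$, such that for every irrational $\alpha$, every integer $K\ge 0$ and every integer $N$ with $q_K\le N<q_{K+1}$, \[ \Bigg| \sum_{\substack{1\le n\le N\\ \|n\alpha\|\ge c/N}} \frac{1}{\|n\alpha\|} - 2N\log N \Bigg| \le C\left(a_{K+1}^{1/2}+\log^* s_{K+1}\right)N , \] and, if in addition $4(c\,a_{K+1})^{1/2}q_K\le N$, then \[ \sum_{\substack{1\le n\le N\\ \|n\alpha\|\ge c/N}} \frac{1}{\|n\alpha\|} \ge 2N\log N+q_{K+1}-C\,(\log^* s_{K+1})\,N . \] -/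

import Mathlib

/-- `‖x‖`: the distance from the real number `x` to the nearest integer. -/
noncomputable def distNearestInt (x : ℝ) : ℝ := |x - round x|

/-- The `k`-th partial quotient `a_k` of the continued fraction `α = [a_0; a_1, a_2, …]`.
The `k`-th entry of Mathlib's sequence `partDens` is `a_{k+1}`; for irrational `α` the expansion
does not terminate, so the default value is never used. -/
noncomputable def partialQuotient (α : ℝ) : ℕ → ℝ
  | 0 => (GenContFract.of α).h
  | k + 1 => ((GenContFract.of α).partDens.get? k).getD 0

/-- The denominator `q_k` of the `k`-th convergent `p_k / q_k = [a_0; a_1, …, a_k]` of `α`. -/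
noncomputable def convergentDenom (α : ℝ) (k : ℕ) : ℝ := (GenContFract.of α).dens k

/-- `s_K = a_1 + ⋯ + a_K`. -/
noncomputable def partialQuotientSum (α : ℝ) (K : ℕ) : ℝ :=
  ∑ k ∈ Finset.Icc 1 K, partialQuotient α k

/-- The logarithm as it occurs in error terms, `log max {e, x}`. -/
noncomputable def errorLog (x : ℝ) : ℝ := Real.log (max (Real.exp 1) x)

open Classical in
/-- The sum of `1 / ‖n α‖` over the integers `1 ≤ n ≤ N` with `‖n α‖ ≥ c / N`. -/
noncomputable def truncatedReciprocalSum (c α : ℝ) (N : ℕ) : ℝ :=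
  ∑ n ∈ Finset.Icc 1 N with c / (N : ℝ) ≤ distNearestInt ((n : ℝ) * α),
    1 / distNearestInt ((n : ℝ) * α)

/-! Let `S = (1 + c) s_{K+1}` and cut `1/‖x‖` off at height `N/S`. The truncated function has
variation `O(N/S)` over a period, so expanding `N` greedily in the `q_k` and applying Denjoy–Koksma
to each block gives its sum over `n α`, `n ≤ N`, as `N` times its integral, with error `O(s_{K+1}
N/S) = O(N)`. The integral is `2 log N + O(1 + log S)`. This is the main term
(`abs_sum_truncatedReciprocal_sub_le`).

What is left concerns the `n` with `‖n α‖ < S/N` (`truncatedReciprocalSum_split`). The truncated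
function counts each of them with weight `N/S`, in total `O(N)`; the true sum has instead the middle
sum of `1/‖n α‖` over `c/N ≤ ‖n α‖ < S/N`. The middle sum is nonnegative, so only its upper bound
costs `a_{K+1}^{1/2}`.

For that bound, cut at `1/(2 q_K)`. Above it, blocks of `q_K` consecutive `n` give `1/(2
q_K)`-separated points, and harmonic sums yield `O((1 + log S) N)` (`sum_far_le`). Below it lie only
`O(N/q_K)` points, separated by `1/(2 q_{K+1})`; writing `1/d` as the square of `d^{-1/2}` and using
`d ≥ c/N` in one factor gives `O((a_{K+1}/c)^{1/2} N)` (`sum_near_le`).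

For the sharper lower bound, keep in the middle sum only `n = j q_K`, where `‖n α‖ = j ‖q_K α‖` and
`1/‖q_K α‖ > q_{K+1}`. If `N` is large the admissible `j` span a factor of at least `e`, so these
terms alone contribute `q_{K+1}` (`le_sum_multiples`). -/

/-- The numerators `p`, denominators `q` and partial quotients `A` of the regular continued
fraction expansion of an irrational number `α`, as integer sequences. -/
structure IsConvergentData (α : ℝ) (p : ℕ → ℤ) (q A : ℕ → ℕ) : Prop where
  one_le_A : ∀ k, 1 ≤ A (k + 1)
  q_zero : q 0 = 1
  q_one : q 1 = A 1
  q_rec : ∀ k, q (k + 2) = A (k + 2) * q (k + 1) + q k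
  p_rec : ∀ k, p (k + 2) = A (k + 2) * p (k + 1) + p k
  det : ∀ k, p k * q (k + 1) - q k * p (k + 1) = (-1) ^ (k + 1)
  err_pos : ∀ k, 0 < (-1) ^ k * ((q k : ℝ) * α - p k)

/-! ### Existence of the convergent data -/

open GenContFract in
lemma not_terminatedAt_of_irrational {α : ℝ} (h : Irrational α) (n : ℕ) :
    ¬ (GenContFract.of α).TerminatedAt n := by
  intro hn
  obtain ⟨r, hr⟩ := (GenContFract.terminates_iff_rat α).1 ⟨n, hn⟩
  exact h ⟨r, hr.symm⟩

open GenContFract in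
lemma exists_partialQuotient_eq {α : ℝ} (h : Irrational α) (k : ℕ) :
    ∃ a : ℕ, (GenContFract.of α).s.get? k = some ⟨1, (a : ℝ)⟩ ∧
      partialQuotient α (k + 1) = a ∧ 1 ≤ a := by
  obtain ⟨gp, hgp⟩ := Option.ne_none_iff_exists'.1 (not_terminatedAt_of_irrational h k)
  obtain ⟨h1, z, hz⟩ := of_partNum_eq_one_and_exists_int_partDen_eq hgp
  have hb : (GenContFract.of α).partDens.get? k = some gp.b := partDen_eq_s_b hgp
  have hone := of_one_le_get?_partDen hb
  have hz1 : (1 : ℤ) ≤ z := by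
    rw [hz] at hone
    exact_mod_cast hone
  obtain ⟨a, rfl⟩ := Int.eq_ofNat_of_zero_le (show 0 ≤ z by omega)
  have hgb : gp.b = (a : ℝ) := by rw [hz]; simp
  refine ⟨a, ?_, ?_, by omega⟩
  · rw [hgp]
    cases gp
    simp_all
  · simp [partialQuotient, hb, hgb]

open GenContFract in
lemma sub_convs_sign {α : ℝ} (h : Irrational α) (k : ℕ) :
    0 < (-1) ^ k * (α - (GenContFract.of α).convs k) := by
  have hnt := not_terminatedAt_of_irrational h
  obtain ⟨ifp', h'⟩ := Option.ne_none_iff_exists'.1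
    ((not_congr of_terminatedAt_n_iff_succ_nth_intFractPair_stream_eq_none).1 (hnt k))
  obtain ⟨ifp, hs, hfr, -⟩ := IntFractPair.succ_nth_stream_eq_some_iff.1 h'
  have hsub := sub_convs_eq hs
  simp only [hfr, if_false] at hsub
  have hfr0 : 0 < ifp.fr := lt_of_le_of_ne (IntFractPair.nth_stream_fr_nonneg hs) (Ne.symm hfr)
  have hB : (0 : ℝ) < ((GenContFract.of α).contsAux (k + 1)).b := by
    have := fib_le_of_contsAux_b (v := α) (n := k + 1) (Or.inr (hnt _))
    exact lt_of_lt_of_le (by exact_mod_cast Nat.fib_pos.2 k.succ_pos) this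
  have hpB : (0 : ℝ) ≤ ((GenContFract.of α).contsAux k).b := zero_le_of_contsAux_b
  rw [hsub, ← mul_div_assoc, ← mul_pow]
  norm_num
  positivity

open GenContFract in
lemma exists_convergentData {α : ℝ} (h : Irrational α) :
    ∃ (p : ℕ → ℤ) (q A : ℕ → ℕ), IsConvergentData α p q A ∧
      (∀ k, convergentDenom α k = q k) ∧ ∀ k, partialQuotient α (k + 1) = A (k + 1) := by
  choose a ha hpq hone using exists_partialQuotient_eq h
  have hd0 : (GenContFract.of α).dens 0 = 1 := by simp
  have hd1 : (GenContFract.of α).dens 1 = a 0 := by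
    rw [first_den_eq (ha 0)]
  have hn0 : (GenContFract.of α).nums 0 = ⌊α⌋ := by simp
  have hn1 : (GenContFract.of α).nums 1 = a 0 * ⌊α⌋ + 1 := by
    rw [first_num_eq (ha 0)]; simp
  have hd : ∀ k, (GenContFract.of α).dens (k + 2) =
      a (k + 1) * (GenContFract.of α).dens (k + 1) + (GenContFract.of α).dens k := fun k => by
    rw [dens_recurrence (ha (k + 1)) rfl rfl]; simp
  have hn : ∀ k, (GenContFract.of α).nums (k + 2) =
      a (k + 1) * (GenContFract.of α).nums (k + 1) + (GenContFract.of α).nums k := fun k => by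
    rw [nums_recurrence (ha (k + 1)) rfl rfl]; simp
  have hq : ∀ k, (∃ b : ℕ, (GenContFract.of α).dens k = b) ∧
      ∃ b : ℕ, (GenContFract.of α).dens (k + 1) = b := by
    intro k
    induction k with
    | zero => exact ⟨⟨1, by simp⟩, ⟨a 0, hd1⟩⟩
    | succ k ih =>
      obtain ⟨⟨b, hb⟩, ⟨b', hb'⟩⟩ := ih
      exact ⟨⟨b', hb'⟩, ⟨a (k + 1) * b' + b, by rw [hd, hb, hb']; push_cast; ring⟩⟩
  have hp : ∀ k, (∃ b : ℤ, (GenContFract.of α).nums k = b) ∧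
      ∃ b : ℤ, (GenContFract.of α).nums (k + 1) = b := by
    intro k
    induction k with
    | zero => exact ⟨⟨⌊α⌋, hn0⟩, ⟨a 0 * ⌊α⌋ + 1, by rw [hn1]; push_cast; ring⟩⟩
    | succ k ih =>
      obtain ⟨⟨b, hb⟩, ⟨b', hb'⟩⟩ := ih
      exact ⟨⟨b', hb'⟩, ⟨a (k + 1) * b' + b, by rw [hn, hb, hb']; push_cast; ring⟩⟩
  choose q hq using fun k => (hq k).1
  choose p hp using fun k => (hp k).1
  simp only [hq] at hd hd0 hd1
  simp only [hp] at hn hn0 hn1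
  have hqpos : ∀ k, 0 < q k ∧ 0 < q (k + 1) := by
    intro k
    have h0 : q 0 = 1 := by exact_mod_cast hd0
    have h1 : q 1 = a 0 := by exact_mod_cast hd1
    induction k with
    | zero => have := hone 0; simp only [zero_add]; omega
    | succ k ih =>
      have : q (k + 2) = a (k + 1) * q (k + 1) + q k := by exact_mod_cast hd k
      refine ⟨ih.2, ?_⟩
      rw [this]
      have := ih.1
      positivity
  refine ⟨p, q, fun k => a (k - 1), ⟨fun k => hone k, by exact_mod_cast hd0,
    by simpa using hd1, fun k => by exact_mod_cast hd k, fun k => by exact_mod_cast hn k,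
    fun k => ?_, fun k => ?_⟩, fun k => hq k, fun k => hpq k⟩
  · have := (SimpContFract.of α).determinant (n := k) (not_terminatedAt_of_irrational h k)
    change (GenContFract.of α).nums k * (GenContFract.of α).dens (k + 1) -
      (GenContFract.of α).dens k * (GenContFract.of α).nums (k + 1) = _ at this
    rw [hq, hq, hp, hp] at this
    exact_mod_cast this
  · have := sub_convs_sign h k
    rw [conv_eq_num_div_den, hq, hp] at this
    have hk : (0 : ℝ) < q k := by exact_mod_cast (hqpos k).1
    have h2 : (-1) ^ k * ((q k : ℝ) * α - p k) = q k * ((-1) ^ k * (α - p k / q k)) := by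
      field_simp
    rw [h2]
    positivity

/-! ### Approximation by convergents -/

namespace IsConvergentData

variable {α : ℝ} {p : ℕ → ℤ} {q A : ℕ → ℕ}

/-- The absolute value of `q k * α - p k`. -/
noncomputable def err (α : ℝ) (p : ℕ → ℤ) (q : ℕ → ℕ) (k : ℕ) : ℝ :=
  (-1) ^ k * ((q k : ℝ) * α - p k)

lemma q_pos (h : IsConvergentData α p q A) (k : ℕ) : 0 < q k := by
  have : 0 < q k ∧ 0 < q (k + 1) := by
    induction k with
    | zero =>
      have := h.one_le_A 0
      have h0 := h.q_zero
      have h1 := h.q_one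
      simp only [zero_add] at *
      omega
    | succ k ih =>
      refine ⟨ih.2, ?_⟩
      rw [h.q_rec]
      have := ih.1
      positivity
  exact this.1

lemma q_le_succ (h : IsConvergentData α p q A) (k : ℕ) : q k ≤ q (k + 1) := by
  cases k with
  | zero =>
    rw [h.q_zero]
    exact h.q_pos 1
  | succ k =>
    rw [h.q_rec]
    have : q (k + 1) ≤ A (k + 2) * q (k + 1) :=
      Nat.le_mul_of_pos_left (q (k + 1)) (h.one_le_A (k + 1))
    omega

lemma q_succ_le (h : IsConvergentData α p q A) (k : ℕ) :
    q (k + 1) ≤ (A (k + 1) + 1) * q k := by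
  cases k with
  | zero =>
    simp only [zero_add, h.q_zero, h.q_one]
    omega
  | succ k =>
    have := h.q_le_succ k
    rw [h.q_rec, add_mul, one_mul]
    exact Nat.add_le_add_left this _

/-- The determinant identity with `α` eliminated; consecutive errors have opposite signs, so
absolute values add. Both the upper and the lower bound for `err` come from it. -/
lemma err_add_err (h : IsConvergentData α p q A) (k : ℕ) :
    q (k + 1) * err α p q k + q k * err α p q (k + 1) = 1 := by
  have hdet : (p k : ℝ) * q (k + 1) - q k * p (k + 1) = (-1) ^ (k + 1) := by
    exact_mod_cast h.det k
  have hs : ((-1 : ℝ) ^ k) * (-1) ^ k = 1 := by rw [← mul_pow]; norm_num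
  unfold err
  rw [pow_succ] at hdet ⊢
  linear_combination (-(-1) ^ k) * hdet + hs

lemma abs_eq_err (h : IsConvergentData α p q A) (k : ℕ) :
    |(q k : ℝ) * α - p k| = err α p q k := by
  have := abs_of_pos (h.err_pos k)
  rw [err, ← this, abs_mul]
  simp

lemma err_pos' (h : IsConvergentData α p q A) (k : ℕ) : 0 < err α p q k := h.err_pos k

lemma err_succ_le (h : IsConvergentData α p q A) (k : ℕ) : err α p q (k + 1) ≤ err α p q k := by
  have h1 := h.err_pos' (k + 2)
  have h2 := h.err_pos' (k + 1)
  have hA : (1 : ℝ) ≤ A (k + 2) := by exact_mod_cast h.one_le_A (k + 1)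
  have hrec : err α p q (k + 2) = err α p q k - A (k + 2) * err α p q (k + 1) := by
    unfold err
    rw [h.q_rec, h.p_rec]
    push_cast
    ring
  nlinarith

lemma err_lt (h : IsConvergentData α p q A) (k : ℕ) : err α p q k < 1 / q (k + 1) := by
  have h0 : (0 : ℝ) < q k := by exact_mod_cast h.q_pos k
  have h1 : (0 : ℝ) < q (k + 1) := by exact_mod_cast h.q_pos (k + 1)
  have := h.err_add_err k
  have := mul_pos h0 (h.err_pos' (k + 1))
  rw [lt_div_iff₀ h1]
  linarith

lemma le_err (h : IsConvergentData α p q A) (k : ℕ) :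
    1 / ((q k : ℝ) + q (k + 1)) ≤ err α p q k := by
  have h0 : (0 : ℝ) < q k := by exact_mod_cast h.q_pos k
  have h1 : (0 : ℝ) < q (k + 1) := by exact_mod_cast h.q_pos (k + 1)
  have := h.err_add_err k
  have := mul_le_mul_of_nonneg_left (h.err_succ_le k) h0.le
  rw [div_le_iff₀ (by positivity)]
  linarith

lemma coprime (h : IsConvergentData α p q A) (k : ℕ) : IsCoprime (p k) (q k : ℤ) := by
  have hdet := h.det k
  have hs : ((-1 : ℤ) ^ (k + 1)) * (-1) ^ (k + 1) = 1 := by rw [← mul_pow]; norm_num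
  refine ⟨(-1) ^ (k + 1) * q (k + 1), -((-1) ^ (k + 1) * p (k + 1)), ?_⟩
  linear_combination (-1) ^ (k + 1) * hdet + hs

/-- The law of best approximation. -/
lemma err_le_abs_sub (h : IsConvergentData α p q A) {k n : ℕ} (hn : 0 < n) (hnq : n < q (k + 1))
    (m : ℤ) : err α p q k ≤ |(n : ℝ) * α - m| := by
  have hdet := h.det k
  have hs : ((-1 : ℤ) ^ k) * (-1) ^ k = 1 := by rw [← mul_pow]; norm_num
  have hsR : ((-1 : ℝ) ^ k) * (-1) ^ k = 1 := by rw [← mul_pow]; norm_num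
  rw [pow_succ] at hdet
  -- `x` and `y` are the coordinates of `(n, m)` in the unimodular basis formed by two consecutive
  -- convergents.
  obtain ⟨x, hx⟩ : ∃ x : ℤ, x = (-1) ^ k * (n * p (k + 1) - m * q (k + 1)) := ⟨_, rfl⟩
  obtain ⟨y, hy⟩ : ∃ y : ℤ, y = (-1) ^ k * (m * q k - n * p k) := ⟨_, rfl⟩
  have hnxy : (n : ℤ) = x * q k + y * q (k + 1) := by
    rw [hx, hy]
    linear_combination ((-1) ^ k * n) * hdet - n * hs
  have hmxy : m = x * p k + y * p (k + 1) := by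
    rw [hx, hy]
    linear_combination ((-1) ^ k * m) * hdet - m * hs
  have hval : (n : ℝ) * α - m = (-1) ^ k * (x * err α p q k - y * err α p q (k + 1)) := by
    have h1 : (n : ℝ) = x * q k + y * q (k + 1) := by exact_mod_cast hnxy
    have h2 : (m : ℝ) = x * p k + y * p (k + 1) := by exact_mod_cast hmxy
    rw [h1, h2]
    unfold err
    rw [pow_succ]
    linear_combination (-(x * (q k * α - p k)) - y * (q (k + 1) * α - p (k + 1))) * hsR
  have habs : |(n : ℝ) * α - m| = |x * err α p q k - y * err α p q (k + 1)| := by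
    rw [hval, abs_mul]
    simp
  rw [habs]
  have hq0 : (0 : ℤ) < q k := by exact_mod_cast h.q_pos k
  have hq1 : (0 : ℤ) < q (k + 1) := by exact_mod_cast h.q_pos (k + 1)
  have he0 := h.err_pos' k
  have he1 := h.err_pos' (k + 1)
  have hnZ : (0 : ℤ) < n := by exact_mod_cast hn
  have hnqZ : (n : ℤ) < q (k + 1) := by exact_mod_cast hnq
  -- Since `0 < n < q (k + 1)`, `x` is nonzero and `x`, `y` cannot have the same strict sign. As
  -- consecutive errors alternate in sign, the two contributions then reinforce each other.
  rcases le_or_gt y 0 with hy0 | hy0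
  · have hx1 : 1 ≤ x := by
      by_contra hcon
      have : x ≤ 0 := by omega
      nlinarith
    have hxR : (1 : ℝ) ≤ x := by exact_mod_cast hx1
    have hyR : (y : ℝ) ≤ 0 := by exact_mod_cast hy0
    refine le_trans ?_ (le_abs_self _)
    nlinarith
  · have hx1 : x ≤ -1 := by
      by_contra hcon
      have : 0 ≤ x := by omega
      have : 1 ≤ y := hy0
      nlinarith
    have hxR : (x : ℝ) ≤ -1 := by exact_mod_cast hx1
    have hyR : (0 : ℝ) < y := by exact_mod_cast hy0
    refine le_trans ?_ (neg_le_abs _)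
    nlinarith

/-- Applied to differences of indices, this is the separation modulo one of the points `n α` within
a block of length `q k`. -/
lemma le_distNearestInt (h : IsConvergentData α p q A) {k n : ℕ} (hn : 0 < n) (hnq : n < q k) :
    1 / (2 * (q k : ℝ)) ≤ distNearestInt (n * α) := by
  cases k with
  | zero => rw [h.q_zero] at hnq; omega
  | succ k =>
    refine le_trans (le_trans ?_ (h.le_err k)) (h.err_le_abs_sub hn hnq _)
    have h0 : (0 : ℝ) < q k := by exact_mod_cast h.q_pos k
    have h1 : (q k : ℝ) ≤ q (k + 1) := by exact_mod_cast h.q_le_succ k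
    gcongr
    linarith

end IsConvergentData

/-! ### Distance to the nearest integer -/

section DistNearestInt

lemma distNearestInt_nonneg (x : ℝ) : 0 ≤ distNearestInt x := abs_nonneg _

lemma distNearestInt_le_abs_sub (x : ℝ) (m : ℤ) : distNearestInt x ≤ |x - m| := round_le x m

lemma distNearestInt_eq_norm (x : ℝ) : distNearestInt x = ‖(x : UnitAddCircle)‖ :=
  UnitAddCircle.norm_eq.symm

lemma continuous_distNearestInt : Continuous distNearestInt := by
  have : distNearestInt = fun x : ℝ => ‖(x : UnitAddCircle)‖ := funext distNearestInt_eq_norm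
  rw [this]
  exact continuous_norm.comp (AddCircle.continuous_mk' 1)

lemma distNearestInt_add_int (x : ℝ) (m : ℤ) : distNearestInt (x + m) = distNearestInt x := by
  simp [distNearestInt]

lemma distNearestInt_neg (x : ℝ) : distNearestInt (-x) = distNearestInt x := by
  simp [distNearestInt_eq_norm]

lemma distNearestInt_of_abs_le {x : ℝ} (hx : |x| ≤ 1 / 2) : distNearestInt x = |x| := by
  rw [distNearestInt_eq_norm]
  exact (AddCircle.norm_coe_eq_abs_iff 1 one_ne_zero).2 (by simpa using hx)

end DistNearestInt

/-! ### Denjoy–Koksma and discrepancy -/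

section Equidistribution

variable {f W : ℝ → ℝ} {V : ℝ}

/-- `W` dominates the variation of the `1`-periodic function `f`, whose variation over a period is
at most `V`. -/
structure DominatesVariation (f W : ℝ → ℝ) (V : ℝ) : Prop where
  cont : Continuous f
  periodic : Function.Periodic f 1
  abs_sub_le : ∀ u v, u ≤ v → |f v - f u| ≤ W v - W u
  W_add_one : ∀ x, W (x + 1) = W x + V

lemma DominatesVariation.f_add_int (h : DominatesVariation f W V) (x : ℝ) (m : ℤ) :
    f (x + m) = f x := by
  have := h.periodic.int_mul m x
  simpa using this

lemma DominatesVariation.W_mono (h : DominatesVariation f W V) : Monotone W := fun u v huv => by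
  have := (abs_nonneg _).trans (h.abs_sub_le u v huv)
  linarith

lemma DominatesVariation.V_nonneg (h : DominatesVariation f W V) : 0 ≤ V := by
  have := h.W_mono (show (0 : ℝ) ≤ 0 + 1 by norm_num)
  rw [h.W_add_one] at this
  linarith

lemma DominatesVariation.abs_sub_le_of_mem (h : DominatesVariation f W V) {a b y z : ℝ}
    (hy : y ∈ Set.Icc a b) (hz : z ∈ Set.Icc a b) : |f y - f z| ≤ W b - W a := by
  rcases le_total y z with hyz | hyz
  · rw [abs_sub_comm]
    have := h.W_mono hy.1
    have := h.W_mono hz.2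
    have := h.abs_sub_le y z hyz
    linarith
  · have := h.W_mono hz.1
    have := h.W_mono hy.2
    have := h.abs_sub_le z y hyz
    linarith

/-- Comparison of a value of `f` with its mean over a short interval. -/
lemma DominatesVariation.abs_sub_mean_le (h : DominatesVariation f W V) {u y δ : ℝ} (hδ : 0 < δ)
    (hy : |y - u| ≤ δ) :
    |f y - δ⁻¹ * ∫ t in u..(u + δ), f t| ≤ W (u + δ) - W (u - δ) := by
  have hy' := abs_le.1 hy
  have hint : ∫ t in u..(u + δ), (f y - f t) = δ * f y - ∫ t in u..(u + δ), f t := by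
    rw [intervalIntegral.integral_sub (by simp) (h.cont.intervalIntegrable _ _)]
    simp
  have hbound : ‖∫ t in u..(u + δ), (f y - f t)‖ ≤ (W (u + δ) - W (u - δ)) * |u + δ - u| := by
    apply intervalIntegral.norm_integral_le_of_norm_le_const
    intro t ht
    rw [Set.uIoc_of_le (by linarith)] at ht
    exact h.abs_sub_le_of_mem ⟨by linarith, by linarith⟩ ⟨by linarith [ht.1], ht.2⟩
  have e : f y - δ⁻¹ * ∫ t in u..(u + δ), f t = δ⁻¹ * ∫ t in u..(u + δ), (f y - f t) := by
    rw [hint]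
    field_simp
  rw [e, abs_mul, abs_of_pos (inv_pos.2 hδ)]
  rw [Real.norm_eq_abs, add_sub_cancel_left, abs_of_pos hδ] at hbound
  calc δ⁻¹ * |∫ t in u..(u + δ), (f y - f t)|
      ≤ δ⁻¹ * ((W (u + δ) - W (u - δ)) * δ) := by gcongr
    _ = _ := by field_simp

/-- Each sample is compared with the mean over its own cell of length `1/q`. The comparison costs
the growth of `W` over a window of length `2/q`; these windows cover the period twice, whence `2 *
V`. -/
lemma DominatesVariation.abs_sum_sub_le (h : DominatesVariation f W V) {q : ℕ} (hq : 0 < q)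
    (x : ℝ) (y : ℕ → ℝ) (hy : ∀ j < q, |y j - (x + j / q)| ≤ 1 / q) :
    |∑ j ∈ Finset.range q, f (y j) - q * ∫ t in (0 : ℝ)..1, f t| ≤ 2 * V := by
  have hq0 : (0 : ℝ) < q := by exact_mod_cast hq
  let u : ℕ → ℝ := fun j => x + j / q
  have husucc : ∀ j, u (j + 1) = u j + 1 / q := fun j => by
    simp only [u]
    push_cast
    ring
  have hu0 : u 0 = x := by simp [u]
  have huq : u q = x + 1 := by simp only [u]; field_simp
  have hint : ∫ t in (0 : ℝ)..1, f t =
      ∑ j ∈ Finset.range q, ∫ t in (u j)..(u j + 1 / q), f t := by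
    have h1 := intervalIntegral.sum_integral_adjacent_intervals (f := f)
      (μ := MeasureTheory.volume) (a := u) (n := q)
      (fun k _ => h.cont.intervalIntegrable _ _)
    simp only [husucc] at h1
    rw [h1, hu0, huq, h.periodic.intervalIntegral_add_eq x 0, zero_add]
  have hW : ∑ j ∈ Finset.range q, (W (u j + 1 / q) - W (u j - 1 / q)) = 2 * V := by
    have e1 : ∑ j ∈ Finset.range q, (W (u (j + 1)) - W (u j)) = V := by
      rw [Finset.sum_range_sub (fun j => W (u j)), hu0, huq, h.W_add_one]
      ring
    have e2 : ∑ j ∈ Finset.range q, (W (u (j + 1) - 1 / q) - W (u j - 1 / q)) = V := by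
      rw [Finset.sum_range_sub (fun j => W (u j - 1 / q)), hu0, huq,
        show x + 1 - 1 / (q : ℝ) = x - 1 / q + 1 by ring, h.W_add_one]
      ring
    rw [two_mul]
    nth_rewrite 1 [← e1]
    rw [← e2, ← Finset.sum_add_distrib]
    refine Finset.sum_congr rfl fun j _ => ?_
    rw [husucc, add_sub_cancel_right]
    ring
  rw [hint, Finset.mul_sum, ← Finset.sum_sub_distrib, ← hW]
  refine (Finset.abs_sum_le_sum_abs _ _).trans (Finset.sum_le_sum fun j hj => ?_)
  have := h.abs_sub_mean_le (u := u j) (y := y j) (δ := 1 / q) (by positivity)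
    (hy j (Finset.mem_range.1 hj))
  simpa using this

/-- The Denjoy–Koksma inequality. -/
lemma DominatesVariation.denjoy_koksma (h : DominatesVariation f W V) {q : ℕ} (hq : 0 < q)
    {p : ℤ} (hpq : IsCoprime p (q : ℤ)) {α : ℝ} (hα : |(q : ℝ) * α - p| ≤ 1 / q) (x : ℝ) :
    |∑ n ∈ Finset.range q, f (x + n * α) - q * ∫ t in (0 : ℝ)..1, f t| ≤ 2 * V := by
  have hq0 : (0 : ℝ) < q := by exact_mod_cast hq
  have hqZ : (0 : ℤ) < q := by exact_mod_cast hq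
  obtain ⟨r, s, hrs⟩ := hpq
  -- `r` inverts `p` modulo `q`, so `p * σ j ≡ j` modulo `q`: `σ` reorders the orbit so that its
  -- `j`-th point lies near `x + j / q` modulo one.
  let σ : ℕ → ℕ := fun j => (r * j % q).toNat
  have hσ : ∀ j, (σ j : ℤ) = r * j % q := fun j =>
    Int.toNat_of_nonneg (Int.emod_nonneg _ hqZ.ne')
  have hσlt : ∀ j, σ j < q := fun j => by
    have := Int.emod_lt_of_pos (r * j) hqZ
    rw [← hσ] at this
    exact_mod_cast this
  have hpσ : ∀ j : ℕ, ∃ z : ℤ, p * σ j = j + z * q := fun j => by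
    refine ⟨-s * j - p * (r * j / q), ?_⟩
    rw [hσ, Int.emod_def]
    linear_combination (j : ℤ) * hrs
  have hinj : Set.InjOn σ (Finset.range q : Set ℕ) := by
    intro i hi j hj hij
    obtain ⟨z, hz⟩ := hpσ i
    obtain ⟨w, hw⟩ := hpσ j
    rw [hij, hw] at hz
    have hmod : (i : ℤ) % q = j % q := by
      have : (i : ℤ) = j + (w - z) * q := by linear_combination -hz
      rw [this, Int.add_mul_emod_self_right]
    simp only [Finset.coe_range, Set.mem_Iio] at hi hj
    rw [Int.emod_eq_of_lt (by omega) (by omega), Int.emod_eq_of_lt (by omega) (by omega)] at hmod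
    exact_mod_cast hmod
  have himage : (Finset.range q).image σ = Finset.range q := by
    refine Finset.eq_of_subset_of_card_le ?_ ?_
    · intro i hi
      obtain ⟨j, -, rfl⟩ := Finset.mem_image.1 hi
      exact Finset.mem_range.2 (hσlt j)
    · rw [Finset.card_image_of_injOn hinj]
  choose z hz using hpσ
  have hsum : ∑ n ∈ Finset.range q, f (x + n * α) =
      ∑ j ∈ Finset.range q, f (x + σ j * α + ((-z j : ℤ) : ℝ)) := by
    simp only [h.f_add_int]
    rw [← himage, Finset.sum_image hinj, himage]
  rw [hsum]
  refine h.abs_sum_sub_le hq x _ fun j _ => ?_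
  have hzj : (p : ℝ) * σ j = j + z j * q := by exact_mod_cast hz j
  have e : x + σ j * α + ((-z j : ℤ) : ℝ) - (x + j / q) = σ j / q * (q * α - p) := by
    push_cast
    field_simp
    linear_combination hzj
  rw [e, abs_mul, abs_of_nonneg (by positivity)]
  have h1 : (σ j : ℝ) / q ≤ 1 := by
    rw [div_le_one hq0]
    exact_mod_cast (hσlt j).le
  calc (σ j : ℝ) / q * |q * α - p| ≤ 1 * (1 / q) := by gcongr
    _ = _ := one_mul _

lemma DominatesVariation.denjoy_koksma_mul (h : DominatesVariation f W V) {q : ℕ} (hq : 0 < q)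
    {p : ℤ} (hpq : IsCoprime p (q : ℤ)) {α : ℝ} (hα : |(q : ℝ) * α - p| ≤ 1 / q) (b : ℕ) (x : ℝ) :
    |∑ n ∈ Finset.range (b * q), f (x + n * α) - (b * q : ℕ) * ∫ t in (0 : ℝ)..1, f t| ≤
      2 * V * b := by
  induction b with
  | zero => simp
  | succ b ih =>
    rw [add_mul, one_mul, Finset.sum_range_add]
    have h1 := h.denjoy_koksma hq hpq hα (x + (b * q : ℕ) * α)
    have e : ∀ n : ℕ, x + ((b * q + n : ℕ) : ℝ) * α = x + (b * q : ℕ) * α + n * α := fun n => by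
      push_cast
      ring
    simp only [e]
    rw [abs_le] at *
    push_cast at *
    constructor <;> linarith

/-- The discrepancy bound in terms of the sum of the partial quotients. -/
lemma DominatesVariation.abs_sum_sub_le_sum_partialQuotients (h : DominatesVariation f W V)
    {α : ℝ} {p : ℕ → ℤ} {q A : ℕ → ℕ} (hc : IsConvergentData α p q A) (k : ℕ) :
    ∀ (M : ℕ) (x : ℝ), M < q k →
      |∑ n ∈ Finset.range M, f (x + n * α) - M * ∫ t in (0 : ℝ)..1, f t| ≤
        2 * V * ∑ i ∈ Finset.Icc 1 k, (A i : ℝ) := by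
  induction k with
  | zero =>
    intro M x hM
    rw [hc.q_zero, Nat.lt_one_iff] at hM
    simp [hM]
  | succ k ih =>
    intro M x hM
    have hq := hc.q_pos k
    -- Greedy division: at most `A (k + 1)` full blocks of length `q k`, then a remainder below `q
    -- k`. The remainder starts at a shifted point, so the induction runs over all `x`.
    have hM' : M = M / q k * q k + M % q k := (Nat.div_add_mod' M (q k)).symm
    have hb : M / q k ≤ A (k + 1) := by
      have : M / q k < A (k + 1) + 1 := by
        rw [Nat.div_lt_iff_lt_mul hq]
        exact hM.trans_le (hc.q_succ_le k)
      omega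
    have hbR : ((M / q k : ℕ) : ℝ) ≤ A (k + 1) := by exact_mod_cast hb
    have herr : |(q k : ℝ) * α - p k| ≤ 1 / q k := by
      rw [hc.abs_eq_err]
      refine (hc.err_lt k).le.trans ?_
      have h0 : (0 : ℝ) < q k := by exact_mod_cast hq
      have h1 : (q k : ℝ) ≤ q (k + 1) := by exact_mod_cast hc.q_le_succ k
      gcongr
    have h1 := h.denjoy_koksma_mul hq (hc.coprime k) herr (M / q k) x
    have h2 := ih (M % q k) (x + ((M / q k * q k : ℕ) : ℝ) * α) (Nat.mod_lt _ hq)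
    have hV := mul_le_mul_of_nonneg_left hbR h.V_nonneg
    rw [Finset.sum_Icc_succ_top (by omega)]
    generalize M / q k = b at *
    generalize M % q k = r at *
    subst hM'
    rw [Finset.sum_range_add]
    have e : ∀ n : ℕ, x + ((b * q k + n : ℕ) : ℝ) * α = x + (b * q k : ℕ) * α + n * α :=
      fun n => by
        push_cast
        ring
    simp only [e]
    rw [abs_le] at *
    push_cast at *
    constructor <;> linarith

end Equidistribution

/-! ### The truncated reciprocal: variation and integral -/

section TruncatedReciprocal

/-- The reciprocal of the distance to the nearest integer, truncated at height `1 / η`. -/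
noncomputable def truncatedReciprocal (η x : ℝ) : ℝ := 1 / max (distNearestInt x) η

/-- A function dominating the variation of `truncatedReciprocal η`. -/
noncomputable def truncatedReciprocalVariation (η x : ℝ) : ℝ :=
  2 / η * round x +
    if 0 ≤ x - round x then 1 / η - truncatedReciprocal η x
    else -(1 / η - truncatedReciprocal η x)

variable {η : ℝ}

lemma truncatedReciprocal_pos (hη : 0 < η) (x : ℝ) : 0 < truncatedReciprocal η x :=
  one_div_pos.2 (lt_max_of_lt_right hη)

lemma truncatedReciprocal_le (hη : 0 < η) (x : ℝ) : truncatedReciprocal η x ≤ 1 / η :=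
  one_div_le_one_div_of_le hη (le_max_right _ _)

lemma truncatedReciprocal_anti (hη : 0 < η) {x y : ℝ} (h : distNearestInt x ≤ distNearestInt y) :
    truncatedReciprocal η y ≤ truncatedReciprocal η x :=
  one_div_le_one_div_of_le (lt_max_of_lt_right hη) (max_le_max_right _ h)

lemma continuous_truncatedReciprocal (hη : 0 < η) : Continuous (truncatedReciprocal η) :=
  continuous_const.div (continuous_distNearestInt.max continuous_const)
    fun _ => (lt_max_of_lt_right hη).ne'

/-- Around an integer `m` the function rises to `1 / η` and then falls, and `W` follows it with the
falling half reflected, both halves meeting at `2 m / η`. At half-integers `W` only jumps upwards,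
which is harmless for domination. -/
lemma dominatesVariation_truncatedReciprocal (hη : 0 < η) :
    DominatesVariation (truncatedReciprocal η) (truncatedReciprocalVariation η) (2 / η) where
  cont := continuous_truncatedReciprocal hη
  periodic x := by
    have := distNearestInt_add_int x 1
    rw [Int.cast_one] at this
    simp [truncatedReciprocal, this]
  W_add_one x := by
    have := distNearestInt_add_int x 1
    rw [Int.cast_one] at this
    simp only [truncatedReciprocalVariation, truncatedReciprocal, this, round_add_one]
    push_cast
    rw [show x + 1 - ((round x : ℝ) + 1) = x - round x by ring]
    ring
  abs_sub_le u v huv := by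
    have hu0 := truncatedReciprocal_pos hη u
    have hv0 := truncatedReciprocal_pos hη v
    have hu1 := truncatedReciprocal_le hη u
    have hv1 := truncatedReciprocal_le hη v
    have hη2 : 2 / η = 1 / η + 1 / η := by ring
    have hη0 : 0 < 1 / η := by positivity
    have hround : round u ≤ round v := by
      rw [round_eq, round_eq]
      exact Int.floor_mono (by linarith)
    rcases hround.eq_or_lt with he | hlt
    · unfold truncatedReciprocalVariation
      have e1 : distNearestInt u = |u - round u| := rfl
      have e2 : distNearestInt v = |v - round v| := rfl
      rw [he] at e1 ⊢
      split_ifs with h1 h2 h2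
      · have : distNearestInt u ≤ distNearestInt v := by
          rw [e1, e2, abs_of_nonneg h1, abs_of_nonneg h2]
          linarith
        have := truncatedReciprocal_anti hη this
        rw [abs_le]
        constructor <;> linarith
      · rw [abs_le]
        constructor <;> linarith
      · linarith
      · have : distNearestInt v ≤ distNearestInt u := by
          rw [e1, e2, abs_of_neg (not_le.1 h1), abs_of_neg (not_le.1 h2)]
          linarith
        have := truncatedReciprocal_anti hη this
        rw [abs_le]
        constructor <;> linarith
    · have hR : (round u : ℝ) + 1 ≤ round v := by exact_mod_cast hlt
      have hmul := mul_le_mul_of_nonneg_left hR (show 0 ≤ 2 / η by positivity)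
      unfold truncatedReciprocalVariation
      rw [abs_le]
      split_ifs <;> constructor <;> linarith

lemma integral_truncatedReciprocal_eq_two_mul (hη : 0 < η) :
    ∫ t in (0 : ℝ)..1, truncatedReciprocal η t =
      2 * ∫ t in (0 : ℝ)..(1 / 2), 1 / max t η := by
  have hc := continuous_truncatedReciprocal hη
  rw [← intervalIntegral.integral_add_adjacent_intervals (b := 1 / 2)
    (hc.intervalIntegrable _ _) (hc.intervalIntegrable _ _)]
  have h1 : ∫ t in (1 / 2 : ℝ)..1, truncatedReciprocal η t =
      ∫ t in (0 : ℝ)..(1 / 2), truncatedReciprocal η t := by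
    have h2 : ∫ t in (0 : ℝ)..(1 / 2), truncatedReciprocal η (1 - t) =
        ∫ t in (1 / 2 : ℝ)..1, truncatedReciprocal η t := by
      rw [intervalIntegral.integral_comp_sub_left (fun t => truncatedReciprocal η t)]
      norm_num
    rw [← h2]
    refine intervalIntegral.integral_congr fun t _ => ?_
    have : distNearestInt (1 - t) = distNearestInt t := by
      rw [← distNearestInt_neg t, ← distNearestInt_add_int (-t) 1]
      congr 1
      push_cast
      ring
    simp [truncatedReciprocal, this]
  rw [h1, two_mul]
  have h3 : ∫ t in (0 : ℝ)..(1 / 2), truncatedReciprocal η t =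
      ∫ t in (0 : ℝ)..(1 / 2), 1 / max t η := by
    refine intervalIntegral.integral_congr fun t ht => ?_
    rw [Set.uIcc_of_le (by norm_num)] at ht
    have : distNearestInt t = t := by
      rw [distNearestInt_of_abs_le] <;> rw [abs_of_nonneg ht.1]
      exact ht.2
    simp [truncatedReciprocal, this]
  rw [h3]

lemma integral_truncatedReciprocal (hη : 0 < η) (hη' : η ≤ 1 / 2) :
    ∫ t in (0 : ℝ)..1, truncatedReciprocal η t = 2 + 2 * Real.log (1 / (2 * η)) := by
  have hc : Continuous fun t : ℝ => 1 / max t η :=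
    continuous_const.div (continuous_id.max continuous_const) fun _ => (lt_max_of_lt_right hη).ne'
  rw [integral_truncatedReciprocal_eq_two_mul hη,
    ← intervalIntegral.integral_add_adjacent_intervals (b := η)
    (hc.intervalIntegrable _ _) (hc.intervalIntegrable _ _)]
  have h1 : ∫ t in (0 : ℝ)..η, 1 / max t η = 1 := by
    have : ∫ t in (0 : ℝ)..η, 1 / max t η = ∫ t in (0 : ℝ)..η, 1 / η := by
      refine intervalIntegral.integral_congr fun t ht => ?_
      rw [Set.uIcc_of_le hη.le] at ht
      simp [max_eq_right ht.2]
    rw [this]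
    simp [hη.ne']
  have h2 : ∫ t in η..(1 / 2), 1 / max t η = Real.log (1 / (2 * η)) := by
    have : ∫ t in η..(1 / 2), 1 / max t η = ∫ t in η..(1 / 2), 1 / t := by
      refine intervalIntegral.integral_congr fun t ht => ?_
      rw [Set.uIcc_of_le hη'] at ht
      simp [max_eq_left ht.1]
    rw [this, integral_one_div_of_pos hη (by norm_num)]
    congr 1
    field_simp
  rw [h1, h2]
  ring

lemma abs_integral_truncatedReciprocal_sub_le {S N : ℝ} (hS : 1 ≤ S) (hN : 1 ≤ N) :
    |(∫ t in (0 : ℝ)..1, truncatedReciprocal (S / N) t) - 2 * Real.log N| ≤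
      4 + 2 * Real.log S := by
  have hS0 : 0 < S := by linarith
  have hN0 : 0 < N := by linarith
  have hη : 0 < S / N := by positivity
  have hl2 : 0 < Real.log 2 := Real.log_pos (by norm_num)
  have hl2' : Real.log 2 ≤ 1 := by
    have := Real.log_two_lt_d9
    linarith
  have hlS := Real.log_nonneg hS
  have hlN := Real.log_nonneg hN
  rcases le_or_gt (S / N) (1 / 2) with h | h
  · rw [integral_truncatedReciprocal hη h]
    have : Real.log (1 / (2 * (S / N))) = Real.log N - Real.log S - Real.log 2 := by
      rw [show 1 / (2 * (S / N)) = N / S / 2 by field_simp, Real.log_div (by positivity) (by norm_num),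
        Real.log_div (by positivity) (by positivity)]
    rw [this, abs_le]
    constructor <;> linarith
  -- `S` may exceed `N / 2`; then the function is at most `2` and `log N ≤ log (2 S)`, so both terms
  -- are small.
  · have hlogN : Real.log N ≤ Real.log 2 + Real.log S := by
      rw [← Real.log_mul (by norm_num) hS0.ne']
      apply Real.log_le_log hN0
      rw [lt_div_iff₀ hN0] at h
      linarith
    have hc := continuous_truncatedReciprocal hη
    have h0 : 0 ≤ ∫ t in (0 : ℝ)..1, truncatedReciprocal (S / N) t :=
      intervalIntegral.integral_nonneg (by norm_num) fun t _ => (truncatedReciprocal_pos hη t).le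
    have h1 : ∫ t in (0 : ℝ)..1, truncatedReciprocal (S / N) t ≤ 2 := by
      have : ∫ t in (0 : ℝ)..1, truncatedReciprocal (S / N) t ≤ ∫ t in (0 : ℝ)..1, (2 : ℝ) := by
        refine intervalIntegral.integral_mono_on (by norm_num) (hc.intervalIntegrable _ _)
          (by simp) fun t _ => (truncatedReciprocal_le hη t).trans ?_
        rw [div_le_iff₀ hη]
        linarith
      simpa using this
    rw [abs_le]
    constructor <;> linarith

end TruncatedReciprocal

/-! ### Sums over separated points -/

section Separation

/-- A sum of a function of `⌊‖n α‖ / ρ⌋` over integers `n` for which the points `n α` are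
`ρ`-separated modulo one: each value of the floor is taken at most twice. -/
lemma sum_floor_dist_le {I : Finset ℕ} {α ρ : ℝ} (hρ : 0 < ρ)
    (hsep : ∀ n ∈ I, ∀ m ∈ I, n < m → ρ ≤ distNearestInt ((m - n : ℕ) * α))
    (g : ℕ → ℝ) (hg : ∀ k, 0 ≤ g k) (L : ℕ)
    (hL : ∀ n ∈ I, ⌊distNearestInt (n * α) / ρ⌋₊ < L) :
    ∑ n ∈ I, g ⌊distNearestInt (n * α) / ρ⌋₊ ≤ 2 * ∑ k ∈ Finset.range L, g k := by
  -- The cell of width `ρ` together with the side of the nearest integer determines `n`: two indices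
  -- sharing both would have points closer than `ρ`.
  let κ : ℕ → ℕ × Bool := fun n =>
    (⌊distNearestInt (n * α) / ρ⌋₊, decide (0 ≤ (n : ℝ) * α - round ((n : ℝ) * α)))
  have hne : ∀ n ∈ I, ∀ m ∈ I, n < m → κ n ≠ κ m := by
    intro n hn m hm hnm heq
    have hk : ⌊distNearestInt (n * α) / ρ⌋₊ = ⌊distNearestInt (m * α) / ρ⌋₊ :=
      congrArg Prod.fst heq
    have hs : (0 ≤ (n : ℝ) * α - round ((n : ℝ) * α)) ↔ (0 ≤ (m : ℝ) * α - round ((m : ℝ) * α)) :=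
      decide_eq_decide.1 (congrArg Prod.snd heq)
    have hfl : ∀ i : ℕ, (⌊distNearestInt (i * α) / ρ⌋₊ : ℝ) * ρ ≤ distNearestInt (i * α) ∧
        distNearestInt (i * α) < ((⌊distNearestInt (i * α) / ρ⌋₊ : ℝ) + 1) * ρ := fun i =>
      ⟨(le_div_iff₀ hρ).1 (Nat.floor_le (div_nonneg (distNearestInt_nonneg _) hρ.le)),
        (div_lt_iff₀ hρ).1 (Nat.lt_floor_add_one _)⟩
    have h1 := hfl n
    have h2 := hfl m
    rw [hk] at h1
    generalize ⌊distNearestInt (m * α) / ρ⌋₊ = k at h1 h2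
    have h3 := (hsep n hn m hm hnm).trans
      (distNearestInt_le_abs_sub _ (round ((m : ℝ) * α) - round ((n : ℝ) * α)))
    rw [Nat.cast_sub hnm.le] at h3
    push_cast at h3
    rw [show ((m : ℝ) - n) * α - (round ((m : ℝ) * α) - round ((n : ℝ) * α)) =
      (m * α - round ((m : ℝ) * α)) - (n * α - round ((n : ℝ) * α)) by ring] at h3
    unfold distNearestInt at h1 h2
    refine absurd h3 (not_le.2 ?_)
    by_cases h0 : 0 ≤ (n : ℝ) * α - round ((n : ℝ) * α)
    · rw [abs_of_nonneg h0] at h1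
      rw [abs_of_nonneg (hs.1 h0)] at h2
      rw [abs_lt]
      constructor <;> linarith
    · have h0' := mt hs.2 h0
      rw [abs_of_neg (not_le.1 h0)] at h1
      rw [abs_of_neg (not_le.1 h0')] at h2
      rw [abs_lt]
      constructor <;> linarith
  have hinj : Set.InjOn κ (I : Set ℕ) := by
    intro n hn m hm heq
    rcases lt_trichotomy n m with h | h | h
    · exact absurd heq (hne n hn m hm h)
    · exact h
    · exact absurd heq.symm (hne m hm n hn h)
  calc ∑ n ∈ I, g ⌊distNearestInt (n * α) / ρ⌋₊
      = ∑ x ∈ I.image κ, g x.1 := (Finset.sum_image hinj (f := fun x : ℕ × Bool => g x.1)).symm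
    _ ≤ ∑ x ∈ Finset.range L ×ˢ (Finset.univ : Finset Bool), g x.1 := by
        refine Finset.sum_le_sum_of_subset_of_nonneg ?_ fun _ _ _ => hg _
        intro x hx
        obtain ⟨n, hn, rfl⟩ := Finset.mem_image.1 hx
        exact Finset.mem_product.2 ⟨Finset.mem_range.2 (hL n hn), Finset.mem_univ _⟩
    _ = 2 * ∑ k ∈ Finset.range L, g k := by
        rw [Finset.sum_product, Finset.mul_sum]
        simp

end Separation

/-! ### Blocks of length `q K`: counting and the far range -/

namespace IsConvergentData

variable {α : ℝ} {p : ℕ → ℤ} {q A : ℕ → ℕ} {K N : ℕ}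

/-- A sum over `n ≤ N` is estimated by splitting it into blocks of length `q K`, in each of which
the points `n α` are `1 / (2 q K)`-separated modulo one. -/
lemma sum_le_of_floor_le (hc : IsConvergentData α p q A) (hKN : q K ≤ N) {I : Finset ℕ}
    (hI : I ⊆ Finset.Icc 1 N) {F g : ℕ → ℝ} (hg : ∀ k, 0 ≤ g k) (L : ℕ)
    (hF : ∀ n ∈ I, F n ≤ g ⌊distNearestInt (n * α) / (1 / (2 * (q K : ℝ)))⌋₊)
    (hL : ∀ n ∈ I, ⌊distNearestInt (n * α) / (1 / (2 * (q K : ℝ)))⌋₊ < L) :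
    ∑ n ∈ I, F n ≤ 4 * ((N : ℝ) / q K) * ∑ k ∈ Finset.range L, g k := by
  have hq := hc.q_pos K
  have hq0 : (0 : ℝ) < q K := by exact_mod_cast hq
  have hmaps : ∀ n ∈ I, n / q K ∈ Finset.range (N / q K + 1) := fun n hn => by
    have := (Finset.mem_Icc.1 (hI hn)).2
    exact Finset.mem_range.2 (Nat.lt_succ_of_le (Nat.div_le_div_right this))
  have hblock : ∀ i ∈ Finset.range (N / q K + 1),
      ∑ n ∈ I with n / q K = i, F n ≤ 2 * ∑ k ∈ Finset.range L, g k := by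
    intro i _
    refine (Finset.sum_le_sum fun n hn => hF n (Finset.mem_filter.1 hn).1).trans ?_
    refine sum_floor_dist_le (by positivity) ?_ g hg L fun n hn => hL n (Finset.mem_filter.1 hn).1
    intro n hn m hm hnm
    refine hc.le_distNearestInt (by omega) ?_
    have h1 := (Finset.mem_filter.1 hn).2
    have h2 := (Finset.mem_filter.1 hm).2
    have h3 := Nat.div_add_mod n (q K)
    have h4 := Nat.div_add_mod m (q K)
    have h5 := Nat.mod_lt m hq
    rw [h1] at h3
    rw [h2] at h4
    omega
  rw [← Finset.sum_fiberwise_of_maps_to hmaps]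
  refine (Finset.sum_le_sum hblock).trans ?_
  rw [Finset.sum_const, Finset.card_range, nsmul_eq_mul]
  have hcard : ((N / q K + 1 : ℕ) : ℝ) ≤ 2 * ((N : ℝ) / q K) := by
    have h1 : ((N / q K : ℕ) : ℝ) ≤ (N : ℝ) / q K := Nat.cast_div_le
    have h2 : (1 : ℝ) ≤ (N : ℝ) / q K := by
      rw [one_le_div hq0]
      exact_mod_cast hKN
    push_cast
    linarith
  have hsum : 0 ≤ ∑ k ∈ Finset.range L, g k := Finset.sum_nonneg fun k _ => hg k
  calc ((N / q K + 1 : ℕ) : ℝ) * (2 * ∑ k ∈ Finset.range L, g k)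
      ≤ 2 * ((N : ℝ) / q K) * (2 * ∑ k ∈ Finset.range L, g k) := by gcongr
    _ = _ := by ring

lemma card_dist_lt_le (hc : IsConvergentData α p q A) (hKN : q K ≤ N) {x : ℝ} (hx : 0 < x) :
    (((Finset.Icc 1 N).filter fun n : ℕ => distNearestInt (n * α) < x).card : ℝ) ≤
      4 * ((N : ℝ) / q K) * (2 * q K * x + 1) := by
  have hq0 : (0 : ℝ) < q K := by exact_mod_cast hc.q_pos K
  have h := hc.sum_le_of_floor_le hKN
    (I := (Finset.Icc 1 N).filter fun n : ℕ => distNearestInt (n * α) < x)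
    (Finset.filter_subset _ _) (F := fun _ => 1) (g := fun _ => 1) (fun _ => zero_le_one)
    (⌊x / (1 / (2 * (q K : ℝ)))⌋₊ + 1) (fun _ _ => le_rfl) (fun n hn => by
      have := (Finset.mem_filter.1 hn).2
      refine Nat.lt_succ_of_le (Nat.floor_mono ?_)
      gcongr)
  simp only [Finset.sum_const, Finset.card_range, nsmul_eq_mul, mul_one] at h
  refine h.trans ?_
  have hfl : (⌊x / (1 / (2 * (q K : ℝ)))⌋₊ : ℝ) ≤ 2 * q K * x := by
    refine (Nat.floor_le (by positivity)).trans_eq ?_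
    field_simp
  push_cast
  gcongr

lemma card_near_le (hc : IsConvergentData α p q A) (hKN : q K ≤ N) :
    (((Finset.Icc 1 N).filter
      fun n : ℕ => distNearestInt (n * α) < 1 / (2 * (q K : ℝ))).card : ℝ) ≤
      4 * ((N : ℝ) / q K) := by
  have hq0 : (0 : ℝ) < q K := by exact_mod_cast hc.q_pos K
  have h := hc.sum_le_of_floor_le hKN
    (I := (Finset.Icc 1 N).filter fun n : ℕ => distNearestInt (n * α) < 1 / (2 * (q K : ℝ)))
    (Finset.filter_subset _ _) (F := fun _ => 1) (g := fun _ => 1) (fun _ => zero_le_one)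
    1 (fun _ _ => le_rfl) (fun n hn => by
      have := (Finset.mem_filter.1 hn).2
      rw [Nat.floor_lt (div_nonneg (distNearestInt_nonneg _) (by positivity)), Nat.cast_one,
        div_lt_one (by positivity)]
      exact this)
  simpa using h

/-- Here the cell index `k` is at least `1`, so `1/d ≤ 1/(kρ) ≤ 2/(ρ(k + 1))`. Each block
contributes a harmonic sum of length at most `3 S`, because `q K ≤ N`. -/
lemma sum_far_le (hc : IsConvergentData α p q A) (hKN : q K ≤ N) {S : ℝ} (hS : 1 ≤ S) :
    ∑ n ∈ Finset.Icc 1 N with (1 / (2 * (q K : ℝ)) ≤ distNearestInt ((n : ℕ) * α) ∧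
        distNearestInt (n * α) < S / N), 1 / distNearestInt (n * α) ≤
      16 * N * (3 + Real.log S) := by
  have hq0 : (0 : ℝ) < q K := by exact_mod_cast hc.q_pos K
  have hqN : (q K : ℝ) ≤ N := by exact_mod_cast hKN
  have hN0 : (0 : ℝ) < N := hq0.trans_le hqN
  obtain ⟨ρ, hρ⟩ : ∃ ρ : ℝ, ρ = 1 / (2 * (q K : ℝ)) := ⟨_, rfl⟩
  have hρ0 : 0 < ρ := by rw [hρ]; positivity
  have h := hc.sum_le_of_floor_le hKN
    (I := (Finset.Icc 1 N).filter fun n : ℕ => 1 / (2 * (q K : ℝ)) ≤ distNearestInt (n * α) ∧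
        distNearestInt (n * α) < S / N)
    (Finset.filter_subset _ _) (F := fun n => 1 / distNearestInt (n * α))
    (g := fun k => 2 / ρ * ((k + 1 : ℕ) : ℝ)⁻¹) (fun _ => by positivity)
    (⌊S / N / ρ⌋₊ + 1) (fun n hn => by
      have hd := (Finset.mem_filter.1 hn).2.1
      rw [← hρ] at hd ⊢
      have h1 : 1 ≤ ⌊distNearestInt (n * α) / ρ⌋₊ := by
        rw [Nat.one_le_floor_iff, one_le_div hρ0]
        exact hd
      have h2 : (⌊distNearestInt (n * α) / ρ⌋₊ : ℝ) * ρ ≤ distNearestInt (n * α) :=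
        (le_div_iff₀ hρ0).1 (Nat.floor_le (div_nonneg (distNearestInt_nonneg _) hρ0.le))
      generalize ⌊distNearestInt (n * α) / ρ⌋₊ = k at h1 h2
      have h3 : (1 : ℝ) ≤ k := by exact_mod_cast h1
      have hd0 : 0 < distNearestInt (n * α) := hρ0.trans_le hd
      rw [div_mul_eq_mul_div, ← div_eq_mul_inv, div_div, div_le_div_iff₀ hd0 (by positivity)]
      push_cast
      nlinarith)
    (fun n hn => by
      have := (Finset.mem_filter.1 hn).2.2
      rw [← hρ]
      refine Nat.lt_succ_of_le (Nat.floor_mono ?_)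
      gcongr)
  refine h.trans ?_
  have hH : ∑ k ∈ Finset.range (⌊S / N / ρ⌋₊ + 1), (((k + 1 : ℕ) : ℝ))⁻¹ ≤ 3 + Real.log S := by
    have h1 := harmonic_le_one_add_log (⌊S / N / ρ⌋₊ + 1)
    simp only [harmonic, Rat.cast_sum, Rat.cast_inv, Rat.cast_natCast] at h1
    refine h1.trans ?_
    have h2 : ((⌊S / N / ρ⌋₊ + 1 : ℕ) : ℝ) ≤ 3 * S := by
      have h3 : (⌊S / N / ρ⌋₊ : ℝ) ≤ S / N / ρ := Nat.floor_le (by positivity)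
      have h4 : S / N / ρ ≤ 2 * S := by
        rw [hρ, div_div, div_le_iff₀ (by positivity)]
        have : 1 ≤ 2 * (N * (1 / (2 * (q K : ℝ)))) := by
          rw [show 2 * (N * (1 / (2 * (q K : ℝ)))) = N / q K by field_simp, one_le_div hq0]
          exact hqN
        nlinarith
      push_cast
      linarith
    have h5 := Real.log_le_log (by positivity) h2
    rw [Real.log_mul (by norm_num) (by positivity)] at h5
    have h6 : Real.log 3 ≤ 2 := by
      have := Real.log_le_sub_one_of_pos (show (0 : ℝ) < 3 by norm_num)
      linarith
    linarith
  rw [← Finset.mul_sum]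
  calc 4 * ((N : ℝ) / q K) * (2 / ρ * ∑ k ∈ Finset.range (⌊S / N / ρ⌋₊ + 1), ((k + 1 : ℕ) : ℝ)⁻¹)
      ≤ 4 * ((N : ℝ) / q K) * (2 / ρ * (3 + Real.log S)) := by gcongr
    _ = _ := by
      rw [hρ]
      field_simp
      ring

end IsConvergentData

/-! ### The near range -/

lemma sum_inv_sqrt_le (M : ℕ) :
    ∑ k ∈ Finset.range M, 1 / Real.sqrt ((k + 1 : ℕ) : ℝ) ≤ 2 * Real.sqrt M := by
  induction M with
  | zero => simp
  | succ M ih =>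
    rw [Finset.sum_range_succ]
    have h1 : 0 < Real.sqrt ((M + 1 : ℕ) : ℝ) := Real.sqrt_pos.2 (by positivity)
    have h2 := Real.sq_sqrt (show (0 : ℝ) ≤ ((M + 1 : ℕ) : ℝ) by positivity)
    have h3 := Real.sq_sqrt (show (0 : ℝ) ≤ (M : ℝ) by positivity)
    have h4 := Real.sqrt_nonneg (M : ℝ)
    have h5 : 1 / Real.sqrt ((M + 1 : ℕ) : ℝ) ≤
        2 * Real.sqrt ((M + 1 : ℕ) : ℝ) - 2 * Real.sqrt M := by
      rw [div_le_iff₀ h1]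
      push_cast at *
      nlinarith [sq_nonneg (Real.sqrt ((M : ℝ) + 1) - Real.sqrt M)]
    linarith

lemma log_sub_log_le_sum_inv {m n : ℕ} (hm : 0 < m) (hmn : m ≤ n) :
    Real.log n - Real.log m ≤ ∑ j ∈ Finset.Ico m n, 1 / (j : ℝ) := by
  induction n, hmn using Nat.le_induction with
  | base => simp
  | succ n hmn ih =>
    rw [Finset.sum_Ico_succ_top hmn]
    have hn : (0 : ℝ) < n := by exact_mod_cast hm.trans_le hmn
    have h1 := Real.log_le_sub_one_of_pos (show 0 < ((n + 1 : ℕ) : ℝ) / n by positivity)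
    rw [Real.log_div (by positivity) (by positivity)] at h1
    have h2 : ((n + 1 : ℕ) : ℝ) / n - 1 = 1 / n := by
      push_cast
      field_simp
      ring
    linarith

namespace IsConvergentData

variable {α : ℝ} {p : ℕ → ℤ} {q A : ℕ → ℕ} {K N : ℕ} {c : ℝ}

/-- As `N < q (K + 1)`, all the points are `1/(2 q (K + 1))`-separated, and only `O(N / q K)` of
them are this near. The worst case packs them into the first `M ≈ N / q K` cells: those are summed
by cell, and points farther out are bounded by their number times the value at cell `M`. -/
lemma sum_inv_sqrt_near_le (hc : IsConvergentData α p q A) (hKN : q K ≤ N) (hNK : N < q (K + 1)) :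
    ∑ n ∈ Finset.Icc 1 N with distNearestInt ((n : ℕ) * α) < 1 / (2 * (q K : ℝ)),
        Real.sqrt (1 / distNearestInt (n * α)) ≤
      16 * Real.sqrt (q (K + 1) * (2 * (N / q K))) := by
  have hq0 : (0 : ℝ) < q K := by exact_mod_cast hc.q_pos K
  have hq1 : (0 : ℝ) < q (K + 1) := by exact_mod_cast hc.q_pos (K + 1)
  have hqN : (q K : ℝ) ≤ N := by exact_mod_cast hKN
  obtain ⟨D, hD⟩ : ∃ D : ℝ, D = 1 / (2 * (q (K + 1) : ℝ)) := ⟨_, rfl⟩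
  have hD0 : 0 < D := by rw [hD]; positivity
  obtain ⟨M, hM⟩ : ∃ M : ℕ, M = N / q K + 1 := ⟨_, rfl⟩
  have hM0 : (0 : ℝ) < M := by rw [hM]; positivity
  have hM1 : (N : ℝ) / q K ≤ M := by
    rw [div_le_iff₀ hq0, hM]
    have := Nat.lt_mul_div_succ N (hc.q_pos K)
    rw [mul_comm] at this
    exact_mod_cast this.le
  have hM2 : (M : ℝ) ≤ 2 * (N / q K) := by
    have h1 : ((N / q K : ℕ) : ℝ) ≤ (N : ℝ) / q K := Nat.cast_div_le
    have h2 : (1 : ℝ) ≤ (N : ℝ) / q K := (one_le_div hq0).2 hqN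
    rw [hM]
    push_cast
    linarith
  obtain ⟨I, hI⟩ : ∃ I, I = (Finset.Icc 1 N).filter
    fun n : ℕ => distNearestInt (n * α) < 1 / (2 * (q K : ℝ)) := ⟨_, rfl⟩
  have hcard : (I.card : ℝ) ≤ 4 * M := by
    have := hc.card_near_le hKN
    rw [← hI] at this
    linarith
  obtain ⟨R, hR⟩ : ∃ R : ℝ, R = 2 * Real.sqrt (q (K + 1)) := ⟨_, rfl⟩
  have hR0 : 0 ≤ R := by rw [hR]; positivity
  have hterm : ∀ n ∈ I, Real.sqrt (1 / distNearestInt (n * α)) ≤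
      R * (1 / Real.sqrt ((⌊distNearestInt (n * α) / D⌋₊ + 1 : ℕ) : ℝ)) := by
    intro n hn
    rw [hI, Finset.mem_filter, Finset.mem_Icc] at hn
    have hd : D ≤ distNearestInt (n * α) := by
      rw [hD]
      exact hc.le_distNearestInt (by omega) (by omega)
    have h1 : 1 ≤ ⌊distNearestInt (n * α) / D⌋₊ := by
      rw [Nat.one_le_floor_iff, one_le_div hD0]
      exact hd
    have h2 : (⌊distNearestInt (n * α) / D⌋₊ : ℝ) * D ≤ distNearestInt (n * α) :=
      (le_div_iff₀ hD0).1 (Nat.floor_le (div_nonneg (distNearestInt_nonneg _) hD0.le))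
    generalize ⌊distNearestInt (n * α) / D⌋₊ = k at h1 h2
    have h3 : (1 : ℝ) ≤ k := by exact_mod_cast h1
    have hd0 : 0 < distNearestInt (n * α) := hD0.trans_le hd
    have e : R * (1 / Real.sqrt ((k + 1 : ℕ) : ℝ)) =
        Real.sqrt (4 * q (K + 1) / ((k + 1 : ℕ) : ℝ)) := by
      rw [hR, Real.sqrt_div (by positivity), Real.sqrt_mul (by norm_num),
        show (4 : ℝ) = 2 ^ 2 by norm_num, Real.sqrt_sq (by norm_num)]
      ring
    rw [e]
    apply Real.sqrt_le_sqrt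
    rw [div_le_div_iff₀ hd0 (by positivity)]
    have h4 : 1 = 2 * q (K + 1) * D := by rw [hD]; field_simp
    push_cast
    nlinarith
  have hlow : ∑ n ∈ I with ⌊distNearestInt ((n : ℕ) * α) / D⌋₊ < M,
      Real.sqrt (1 / distNearestInt (n * α)) ≤ 4 * R * Real.sqrt M := by
    have h1 := sum_floor_dist_le (I := I.filter fun n : ℕ => ⌊distNearestInt (n * α) / D⌋₊ < M)
      (α := α) hD0 (fun n hn m hm hnm => by
        simp only [hI, Finset.mem_filter, Finset.mem_Icc] at hn hm
        rw [hD]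
        exact hc.le_distNearestInt (by omega) (by omega))
      (fun k => R * (1 / Real.sqrt ((k + 1 : ℕ) : ℝ))) (fun k => by positivity) M
      (fun n hn => (Finset.mem_filter.1 hn).2)
    refine (Finset.sum_le_sum fun n hn => hterm n (Finset.mem_filter.1 hn).1).trans (h1.trans ?_)
    rw [← Finset.mul_sum]
    have := mul_le_mul_of_nonneg_left (sum_inv_sqrt_le M) hR0
    linarith
  have hhigh : ∑ n ∈ I with ¬ ⌊distNearestInt ((n : ℕ) * α) / D⌋₊ < M,
      Real.sqrt (1 / distNearestInt (n * α)) ≤ 4 * R * Real.sqrt M := by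
    have hsM : 0 < Real.sqrt M := Real.sqrt_pos.2 hM0
    have h1 : ∀ n ∈ I.filter (fun n : ℕ => ¬ ⌊distNearestInt (n * α) / D⌋₊ < M),
        Real.sqrt (1 / distNearestInt (n * α)) ≤ R * (1 / Real.sqrt M) := by
      intro n hn
      rw [Finset.mem_filter, not_lt] at hn
      refine (hterm n hn.1).trans ?_
      have : (M : ℝ) ≤ ((⌊distNearestInt (n * α) / D⌋₊ + 1 : ℕ) : ℝ) := by
        exact_mod_cast hn.2.trans (Nat.le_succ _)
      gcongr
    refine (Finset.sum_le_card_nsmul _ _ _ h1).trans ?_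
    rw [nsmul_eq_mul]
    have h2 : ((I.filter fun n : ℕ => ¬ ⌊distNearestInt (n * α) / D⌋₊ < M).card : ℝ) ≤ 4 * M :=
      le_trans (by exact_mod_cast Finset.card_filter_le _ _) hcard
    calc ((I.filter fun n : ℕ => ¬ ⌊distNearestInt (n * α) / D⌋₊ < M).card : ℝ) *
          (R * (1 / Real.sqrt M)) ≤ 4 * M * (R * (1 / Real.sqrt M)) := by gcongr
      _ = 4 * R * (M / Real.sqrt M) := by ring
      _ = _ := by rw [Real.div_sqrt]
  rw [← hI, ← Finset.sum_filter_add_sum_filter_not I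
    (fun n : ℕ => ⌊distNearestInt (n * α) / D⌋₊ < M)]
  refine (add_le_add hlow hhigh).trans ?_
  have h1 : Real.sqrt (q (K + 1) * M) ≤ Real.sqrt (q (K + 1) * (2 * (N / q K))) := by gcongr
  rw [Real.sqrt_mul hq1.le] at h1
  rw [hR]
  linarith

lemma sum_near_le (hc : IsConvergentData α p q A) (hKN : q K ≤ N) (hNK : N < q (K + 1))
    (hc0 : 0 < c) :
    ∑ n ∈ Finset.Icc 1 N with (c / N ≤ distNearestInt ((n : ℕ) * α) ∧
        distNearestInt (n * α) < 1 / (2 * (q K : ℝ))), 1 / distNearestInt (n * α) ≤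
      32 * Real.sqrt (1 / c) * Real.sqrt (A (K + 1)) * N := by
  have hq0 : (0 : ℝ) < q K := by exact_mod_cast hc.q_pos K
  have hq1 : (0 : ℝ) < q (K + 1) := by exact_mod_cast hc.q_pos (K + 1)
  have hN0 : (0 : ℝ) < N := hq0.trans_le (by exact_mod_cast hKN)
  have hA : (1 : ℝ) ≤ A (K + 1) := by exact_mod_cast hc.one_le_A K
  have hterm : ∀ n ∈ (Finset.Icc 1 N).filter (fun n : ℕ => c / N ≤ distNearestInt (n * α) ∧
        distNearestInt (n * α) < 1 / (2 * (q K : ℝ))), 1 / distNearestInt (n * α) ≤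
      Real.sqrt (N / c) * Real.sqrt (1 / distNearestInt (n * α)) := by
    intro n hn
    have hd := (Finset.mem_filter.1 hn).2.1
    have hd0 : 0 < distNearestInt (n * α) := lt_of_lt_of_le (by positivity) hd
    have h1 : 1 / distNearestInt (n * α) ≤ N / c := by
      rw [← one_div_div c (N : ℝ)]
      gcongr
    nth_rewrite 1 [← Real.mul_self_sqrt (show 0 ≤ 1 / distNearestInt (n * α) by positivity)]
    gcongr
  refine (Finset.sum_le_sum hterm).trans ?_
  rw [← Finset.mul_sum]
  have hsub : ∑ n ∈ Finset.Icc 1 N with (c / N ≤ distNearestInt ((n : ℕ) * α) ∧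
        distNearestInt (n * α) < 1 / (2 * (q K : ℝ))), Real.sqrt (1 / distNearestInt (n * α)) ≤
      16 * Real.sqrt (q (K + 1) * (2 * (N / q K))) := by
    refine le_trans ?_ (hc.sum_inv_sqrt_near_le hKN hNK)
    refine Finset.sum_le_sum_of_subset_of_nonneg ?_ fun _ _ _ => Real.sqrt_nonneg _
    intro n hn
    simp only [Finset.mem_filter] at hn ⊢
    exact ⟨hn.1, hn.2.2⟩
  have hq : (q (K + 1) : ℝ) ≤ 2 * A (K + 1) * q K := by
    have : (q (K + 1) : ℝ) ≤ (A (K + 1) + 1) * q K := by exact_mod_cast hc.q_succ_le K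
    nlinarith
  have hle : (q (K + 1) : ℝ) * (2 * (N / q K)) ≤ 2 ^ 2 * (A (K + 1) * N) := by
    rw [show (q (K + 1) : ℝ) * (2 * (N / q K)) = q (K + 1) * 2 * N / q K by ring, div_le_iff₀ hq0]
    nlinarith
  calc Real.sqrt (N / c) * _ ≤ Real.sqrt (N / c) * (16 * Real.sqrt (2 ^ 2 * (A (K + 1) * N))) := by
        gcongr
        exact hsub.trans (by gcongr)
    _ = 32 * Real.sqrt (1 / c) * Real.sqrt (A (K + 1)) * (Real.sqrt N * Real.sqrt N) := by
        rw [Real.sqrt_mul (by norm_num), Real.sqrt_sq (by norm_num), Real.sqrt_mul (by positivity),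
          show (N : ℝ) / c = N * (1 / c) by ring, Real.sqrt_mul hN0.le]
        ring
    _ = _ := by rw [Real.mul_self_sqrt hN0.le]

/-! ### The multiples of `q K` -/

lemma distNearestInt_multiple (hc : IsConvergentData α p q A) {j : ℕ}
    (hj : (j : ℝ) * (2 * q K) ≤ q (K + 1)) :
    distNearestInt ((j * q K : ℕ) * α) = j * err α p q K := by
  have hq1 : (0 : ℝ) < q (K + 1) := by exact_mod_cast hc.q_pos (K + 1)
  have hδ1 : err α p q K * q (K + 1) < 1 := (lt_div_iff₀ hq1).1 (hc.err_lt K)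
  have h1 : ((j * q K : ℕ) : ℝ) * α = j * (q K * α - p K) + ((j * p K : ℤ) : ℝ) := by
    push_cast
    ring
  have h2 : |(j : ℝ) * (q K * α - p K)| = j * err α p q K := by
    rw [abs_mul, hc.abs_eq_err, Nat.abs_cast]
  rw [h1, distNearestInt_add_int, distNearestInt_of_abs_le, h2]
  rw [h2]
  have hq1' : (1 : ℝ) ≤ q K := by exact_mod_cast hc.q_pos K
  have h3 : (j : ℝ) * 2 ≤ q (K + 1) := by nlinarith [Nat.cast_nonneg (α := ℝ) j]
  have h4 := mul_le_mul_of_nonneg_left h3 (hc.err_pos' K).le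
  linarith

/-- Multiples of `q K` contribute at least `q (K + 1)`. -/
lemma le_sum_multiples (hc : IsConvergentData α p q A) (hKN : q K ≤ N) (hNK : N < q (K + 1))
    (hc0 : 0 < c) {S : ℝ} (hS : (A (K + 1) : ℝ) ≤ S) (hA2 : 2 ≤ A (K + 1))
    (hAc : 36 ≤ c * A (K + 1)) (hN : 4 * Real.sqrt (c * A (K + 1)) * q K ≤ N) :
    (q (K + 1) : ℝ) ≤ ∑ n ∈ Finset.Icc 1 N with (c / N ≤ distNearestInt ((n : ℕ) * α) ∧
        distNearestInt (n * α) < S / N), 1 / distNearestInt (n * α) := by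
  have hq0 : (0 : ℝ) < q K := by exact_mod_cast hc.q_pos K
  have hq1 : (0 : ℝ) < q (K + 1) := by exact_mod_cast hc.q_pos (K + 1)
  have hN0 : (0 : ℝ) < N := hq0.trans_le (by exact_mod_cast hKN)
  have hNq : (N : ℝ) < q (K + 1) := by exact_mod_cast hNK
  have hA2' : (2 : ℝ) ≤ A (K + 1) := by exact_mod_cast hA2
  have hqs : (q (K + 1) : ℝ) ≤ (A (K + 1) + 1) * q K := by exact_mod_cast hc.q_succ_le K
  obtain ⟨δ, hδ⟩ : ∃ δ, δ = err α p q K := ⟨_, rfl⟩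
  have hδ0 : 0 < δ := hδ ▸ hc.err_pos' K
  have hδ1 : δ * q (K + 1) < 1 := (lt_div_iff₀ hq1).1 (hδ ▸ hc.err_lt K)
  have hδ2 : 1 ≤ δ * (q K + q (K + 1)) := (div_le_iff₀ (by positivity)).1 (hδ ▸ hc.le_err K)
  obtain ⟨B, hB⟩ : ∃ B : ℝ, B = N / q K := ⟨_, rfl⟩
  have hBN : B * q K = N := by rw [hB]; field_simp
  have hB4 : 4 * Real.sqrt (c * A (K + 1)) ≤ B := by rw [hB, le_div_iff₀ hq0]; exact hN
  have hs6 : 6 ≤ Real.sqrt (c * A (K + 1)) := Real.le_sqrt_of_sq_le (by norm_num; exact hAc)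
  have hsq := Real.sq_sqrt (show 0 ≤ c * (A (K + 1) : ℝ) by positivity)
  have hB24 : 24 ≤ B := by linarith
  have hBsq : 16 * (c * A (K + 1)) ≤ B ^ 2 := by nlinarith
  have hdist : ∀ j : ℕ, (j : ℝ) * (2 * q K) ≤ N →
      distNearestInt ((j * q K : ℕ) * α) = j * δ := fun j hj =>
    hδ ▸ hc.distNearestInt_multiple (hj.trans hNq.le)
  -- The least `j` with `j * δ ≥ c / N`.
  obtain ⟨m, hm⟩ : ∃ m : ℕ, m = ⌈c / (N * δ)⌉₊ := ⟨_, rfl⟩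
  have hmpos : 0 < m := by
    rw [hm]
    exact Nat.ceil_pos.2 (by positivity)
  have hmle : c ≤ m * (N * δ) := by
    rw [← div_le_iff₀ (by positivity), hm]
    exact Nat.le_ceil _
  -- `c / (N δ) ≤ B / 8` follows from `B ^ 2 ≥ 16 c A`, with `2 ≤ A` used to bound `δ` below;
  -- rounding up costs `1 ≤ B / 24`.
  have hmB : (m : ℝ) ≤ B / 6 := by
    have h1 : (m : ℝ) < c / (N * δ) + 1 := by
      rw [hm]
      exact Nat.ceil_lt_add_one (by positivity)
    have h2 : c / (N * δ) ≤ B / 8 := by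
      rw [div_le_iff₀ (by positivity), ← hBN]
      have h3 : (q K : ℝ) + q (K + 1) ≤ 2 * A (K + 1) * q K := by nlinarith
      have h4 : 1 ≤ δ * (2 * A (K + 1) * q K) := hδ2.trans (by gcongr)
      calc c ≤ c * (δ * (2 * A (K + 1) * q K)) := le_mul_of_one_le_right hc0.le h4
        _ = (16 * (c * A (K + 1))) / 8 * (q K * δ) := by ring
        _ ≤ B ^ 2 / 8 * (q K * δ) := by gcongr
        _ = _ := by ring
    linarith
  obtain ⟨M, hM⟩ : ∃ M : ℕ, M = ⌊B / 2⌋₊ + 1 := ⟨_, rfl⟩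
  have hM1 : B / 2 < M := by
    rw [hM]
    exact_mod_cast Nat.lt_floor_add_one (B / 2)
  have hlt : ∀ j ∈ Finset.Ico m M, (j : ℝ) * (2 * q K) ≤ N := by
    intro j hj
    have h1 : j ≤ ⌊B / 2⌋₊ := by
      have := (Finset.mem_Ico.1 hj).2
      omega
    have h2 : (j : ℝ) ≤ B / 2 := (Nat.le_floor_iff (by positivity)).1 h1
    rw [← hBN]
    nlinarith
  have hmM : m ≤ M := by
    have : (m : ℝ) ≤ M := by linarith
    exact_mod_cast this
  -- `M / m ≥ (B / 2) / (B / 6) = 3 > e`.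
  have hlog : 1 ≤ Real.log M - Real.log m := by
    have hm0 : (0 : ℝ) < m := by exact_mod_cast hmpos
    have hM0 : (0 : ℝ) < M := by linarith
    rw [← Real.log_div hM0.ne' hm0.ne', Real.le_log_iff_exp_le (by positivity),
      le_div_iff₀ hm0]
    have := Real.exp_one_lt_d9
    nlinarith
  have hmain : (q (K + 1) : ℝ) ≤ ∑ j ∈ Finset.Ico m M, 1 / distNearestInt ((j * q K : ℕ) * α) := by
    have h1 := log_sub_log_le_sum_inv hmpos hmM
    have h2 : ∑ j ∈ Finset.Ico m M, 1 / distNearestInt ((j * q K : ℕ) * α) =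
        1 / δ * ∑ j ∈ Finset.Ico m M, 1 / (j : ℝ) := by
      rw [Finset.mul_sum]
      refine Finset.sum_congr rfl fun j hj => ?_
      rw [hdist j (hlt j hj), one_div_mul_one_div, mul_comm]
    rw [h2]
    have h3 : (q (K + 1) : ℝ) ≤ 1 / δ := by
      rw [le_div_iff₀ hδ0]
      linarith
    calc (q (K + 1) : ℝ) ≤ 1 / δ * 1 := by linarith
      _ ≤ _ := by gcongr; linarith
  refine hmain.trans ?_
  have hinj : Set.InjOn (fun j : ℕ => j * q K) (Finset.Ico m M : Set ℕ) := fun i _ j _ hij =>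
    Nat.eq_of_mul_eq_mul_right (hc.q_pos K) hij
  rw [← Finset.sum_image hinj (f := fun n : ℕ => 1 / distNearestInt (n * α))]
  refine Finset.sum_le_sum_of_subset_of_nonneg ?_ fun _ _ _ =>
    one_div_nonneg.2 (distNearestInt_nonneg _)
  intro n hn
  obtain ⟨j, hj, rfl⟩ := Finset.mem_image.1 hn
  have hjN := hlt j hj
  have hmj : (m : ℝ) ≤ j := by exact_mod_cast (Finset.mem_Ico.1 hj).1
  have hjpos : 0 < j := hmpos.trans_le (Finset.mem_Ico.1 hj).1
  rw [Finset.mem_filter, Finset.mem_Icc, hdist j hjN]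
  refine ⟨⟨Nat.mul_pos hjpos (hc.q_pos K), ?_⟩, ?_, ?_⟩
  · have : ((j * q K : ℕ) : ℝ) ≤ N := by
      push_cast
      nlinarith [Nat.cast_nonneg (α := ℝ) j]
    exact_mod_cast this
  · rw [div_le_iff₀ hN0]
    calc c ≤ m * (N * δ) := hmle
      _ ≤ j * (N * δ) := by gcongr
      _ = _ := by ring
  · rw [lt_div_iff₀ hN0]
    have hNδ : N * δ < 1 := by
      have := mul_lt_mul_of_pos_left hNq hδ0
      linarith
    -- `2 j ≤ B ≤ A + 1` gives `j ≤ A ≤ S`, while `N * δ < 1`.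
    have h1 : (j : ℝ) * 2 ≤ B := by rw [hB, le_div_iff₀ hq0]; linarith
    have h2 : B ≤ A (K + 1) + 1 := by
      rw [hB, div_le_iff₀ hq0]
      linarith
    have hj0 : (0 : ℝ) < j := by exact_mod_cast hjpos
    have h3 := mul_lt_mul_of_pos_left hNδ hj0
    linarith

end IsConvergentData

/-! ### Assembling the estimates -/

-- In `truncatedReciprocalSum` the summation variable is elaborated as a real, ranging over the
-- image of `Finset.Icc 1 N` under the cast. Injectivity of the cast restores natural indices.
open Classical in
lemma truncatedReciprocalSum_eq (c α : ℝ) (N : ℕ) :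
    truncatedReciprocalSum c α N =
      ∑ n ∈ Finset.Icc 1 N with c / N ≤ distNearestInt ((n : ℕ) * α),
        1 / distNearestInt (n * α) := by
  have hinj : Set.InjOn (fun n : ℕ => (n : ℝ)) (Finset.Icc 1 N : Set ℕ) :=
    Nat.cast_injective.injOn
  rw [truncatedReciprocalSum, Finset.sum_filter, Finset.sum_filter,
    ← Finset.sum_image hinj (f := fun x : ℝ =>
      if c / N ≤ distNearestInt (x * α) then 1 / distNearestInt (x * α) else 0)]
  refine Finset.sum_congr ?_ fun _ _ => rfl
  ext x
  simp [Finset.bind_def, eq_comm]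

namespace IsConvergentData

variable {α : ℝ} {p : ℕ → ℤ} {q A : ℕ → ℕ} {K N : ℕ} {c : ℝ}

lemma abs_sum_truncatedReciprocal_sub_le (hc : IsConvergentData α p q A) (hN : 1 ≤ N)
    (hNK : N < q (K + 1)) {S : ℝ} (hS1 : 1 ≤ S) (hS : ∑ i ∈ Finset.Icc 1 (K + 1), (A i : ℝ) ≤ S) :
    |∑ n ∈ Finset.Icc 1 N, truncatedReciprocal (S / N) (n * α) - 2 * N * Real.log N| ≤
      (8 + 2 * Real.log S) * N := by
  have hN1 : (1 : ℝ) ≤ N := by exact_mod_cast hN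
  have hN0 : (0 : ℝ) < N := by linarith
  have hS0 : 0 < S := by linarith
  have h1 := (dominatesVariation_truncatedReciprocal (η := S / N)
    (by positivity)).abs_sum_sub_le_sum_partialQuotients hc (K + 1) N α hNK
  have h2 := abs_integral_truncatedReciprocal_sub_le hS1 hN1
  have h3 := mul_le_mul_of_nonneg_left h2 hN0.le
  have hsum : ∑ n ∈ Finset.Icc 1 N, truncatedReciprocal (S / N) (n * α) =
      ∑ n ∈ Finset.range N, truncatedReciprocal (S / N) (α + n * α) := by
    rw [Finset.range_eq_Ico, ← Finset.Ico_add_one_right_eq_Icc,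
      ← Finset.sum_Ico_add' (fun n : ℕ => truncatedReciprocal (S / N) (n * α)) 0 N 1]
    refine Finset.sum_congr rfl fun n _ => ?_
    push_cast
    congr 1
    ring
  -- The choice of truncation height: `S` absorbs the sum of the partial quotients, leaving `O(N)`.
  have h4 : 2 * (2 / (S / N)) * ∑ i ∈ Finset.Icc 1 (K + 1), (A i : ℝ) ≤ 4 * N := by
    calc 2 * (2 / (S / N)) * ∑ i ∈ Finset.Icc 1 (K + 1), (A i : ℝ)
        ≤ 2 * (2 / (S / N)) * S := by gcongr
      _ = 4 * N := by field_simp; ring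
  rw [hsum]
  generalize ∑ n ∈ Finset.range N, truncatedReciprocal (S / N) (α + n * α) = X at *
  generalize ∫ t in (0 : ℝ)..1, truncatedReciprocal (S / N) t = J at *
  rw [← abs_of_pos hN0, ← abs_mul, abs_of_pos hN0] at h3
  rw [abs_le] at *
  constructor <;> linarith

/-- Splitting of the sum at distance `S / N`. -/
lemma truncatedReciprocalSum_split {S : ℝ} (hN : 1 ≤ N) (hcS : c ≤ S) :
    truncatedReciprocalSum c α N +
        N / S * ((Finset.Icc 1 N).filter fun n : ℕ => distNearestInt (n * α) < S / N).card =
      ∑ n ∈ Finset.Icc 1 N, truncatedReciprocal (S / N) (n * α) +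
        ∑ n ∈ Finset.Icc 1 N with (c / N ≤ distNearestInt ((n : ℕ) * α) ∧
          distNearestInt (n * α) < S / N), 1 / distNearestInt (n * α) := by
  have hN0 : (0 : ℝ) < N := by exact_mod_cast hN
  have hdiv : c / N ≤ S / N := by gcongr
  rw [truncatedReciprocalSum_eq, Finset.cast_card, Finset.mul_sum, Finset.sum_filter,
    Finset.sum_filter, Finset.sum_filter, ← Finset.sum_add_distrib, ← Finset.sum_add_distrib]
  refine Finset.sum_congr rfl fun n _ => ?_
  unfold truncatedReciprocal
  by_cases h1 : distNearestInt (n * α) < S / N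
  · rw [max_eq_right h1.le]
    simp only [h1, and_true, if_true, mul_one, one_div_div]
    ring
  · have h2 := not_lt.1 h1
    rw [max_eq_left h2]
    simp [h1, hdiv.trans h2]

/-- The count is at most `8 S + 4 N / q K`, and `N / q K ≤ A (K + 1) + 1 ≤ 2 S`. -/
lemma mul_card_dist_lt_le (hc : IsConvergentData α p q A) (hKN : q K ≤ N) (hNK : N < q (K + 1))
    {S : ℝ} (hS1 : 1 ≤ S) (hAS : (A (K + 1) : ℝ) ≤ S) :
    N / S * ((Finset.Icc 1 N).filter fun n : ℕ => distNearestInt (n * α) < S / N).card ≤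
      16 * (N : ℝ) := by
  have hq0 : (0 : ℝ) < q K := by exact_mod_cast hc.q_pos K
  have hN0 : (0 : ℝ) < N := hq0.trans_le (by exact_mod_cast hKN)
  have hS0 : 0 < S := by linarith
  have h1 := hc.card_dist_lt_le hKN (x := S / N) (by positivity)
  have h2 : (N : ℝ) / q K ≤ 2 * S := by
    rw [div_le_iff₀ hq0]
    have h3 : (N : ℝ) < q (K + 1) := by exact_mod_cast hNK
    have h4 : (q (K + 1) : ℝ) ≤ (A (K + 1) + 1) * q K := by exact_mod_cast hc.q_succ_le K
    nlinarith
  calc N / S * _ ≤ N / S * (4 * ((N : ℝ) / q K) * (2 * q K * (S / N) + 1)) := by gcongr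
    _ = 8 * N + N / S * (4 * (N / q K)) := by field_simp; ring
    _ ≤ 8 * N + N / S * (4 * (2 * S)) := by gcongr
    _ = 16 * N := by field_simp; ring

lemma sum_middle_le (hc : IsConvergentData α p q A) (hKN : q K ≤ N) (hNK : N < q (K + 1))
    (hc0 : 0 < c) {S : ℝ} (hS : 1 ≤ S) :
    ∑ n ∈ Finset.Icc 1 N with (c / N ≤ distNearestInt ((n : ℕ) * α) ∧
        distNearestInt (n * α) < S / N), 1 / distNearestInt (n * α) ≤
      16 * N * (3 + Real.log S) + 32 * Real.sqrt (1 / c) * Real.sqrt (A (K + 1)) * N := by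
  refine le_trans ?_ (add_le_add (hc.sum_far_le hKN hS) (hc.sum_near_le hKN hNK hc0))
  rw [Finset.sum_filter, Finset.sum_filter, Finset.sum_filter, ← Finset.sum_add_distrib]
  refine Finset.sum_le_sum fun n _ => ?_
  have h0 : 0 ≤ 1 / distNearestInt (n * α) := one_div_nonneg.2 (distNearestInt_nonneg _)
  rcases le_or_gt (1 / (2 * (q K : ℝ))) (distNearestInt (n * α)) with h | h
  · simp only [h, true_and, not_lt.2 h, and_false, if_false, add_zero]
    split_ifs with h1 h2
    · exact le_rfl
    · exact absurd h1.2 h2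
    · exact h0
    · exact le_rfl
  · simp only [h, not_le.2 h, false_and, and_true, if_false, zero_add]
    split_ifs with h1 h2
    · exact le_rfl
    · exact absurd h1.1 h2
    · exact h0
    · exact le_rfl

lemma abs_truncatedReciprocalSum_sub_le (hc : IsConvergentData α p q A) (hKN : q K ≤ N)
    (hNK : N < q (K + 1)) (hc0 : 0 < c) {S : ℝ} (hS1 : 1 ≤ S) (hcS : c ≤ S)
    (hS : ∑ i ∈ Finset.Icc 1 (K + 1), (A i : ℝ) ≤ S) (hAS : (A (K + 1) : ℝ) ≤ S) :
    |truncatedReciprocalSum c α N - 2 * N * Real.log N| ≤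
      (56 + 18 * Real.log S + 32 * Real.sqrt (1 / c) * Real.sqrt (A (K + 1))) * N := by
  have hN : 1 ≤ N := (hc.q_pos K).trans_le hKN
  have h1 := hc.abs_sum_truncatedReciprocal_sub_le hN hNK hS1 hS
  have h2 := truncatedReciprocalSum_split (α := α) hN hcS
  have h3 := hc.mul_card_dist_lt_le hKN hNK hS1 hAS
  have h4 := hc.sum_middle_le hKN hNK hc0 hS1
  have h5 : 0 ≤ N / S * (((Finset.Icc 1 N).filter
    fun n : ℕ => distNearestInt (n * α) < S / N).card : ℝ) := by positivity
  have h6 : 0 ≤ ∑ n ∈ Finset.Icc 1 N with (c / N ≤ distNearestInt ((n : ℕ) * α) ∧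
      distNearestInt (n * α) < S / N), 1 / distNearestInt (n * α) :=
    Finset.sum_nonneg fun _ _ => one_div_nonneg.2 (distNearestInt_nonneg _)
  have h7 := mul_nonneg (Real.log_nonneg hS1) (Nat.cast_nonneg (α := ℝ) N)
  have h8 : 0 ≤ 32 * Real.sqrt (1 / c) * Real.sqrt (A (K + 1)) * N := by positivity
  have h9 : (0 : ℝ) ≤ N := Nat.cast_nonneg N
  rw [abs_le] at *
  constructor <;> linarith

lemma le_truncatedReciprocalSum (hc : IsConvergentData α p q A) (hKN : q K ≤ N)
    (hNK : N < q (K + 1)) (hc0 : 0 < c) {S : ℝ} (hS1 : 1 ≤ S) (hcS : c ≤ S)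
    (hS : ∑ i ∈ Finset.Icc 1 (K + 1), (A i : ℝ) ≤ S) (hAS : (A (K + 1) : ℝ) ≤ S)
    (hN4 : 4 * Real.sqrt (c * A (K + 1)) * q K ≤ N) :
    2 * N * Real.log N + q (K + 1) - (27 + 36 / c + 2 * Real.log S) * N ≤
      truncatedReciprocalSum c α N := by
  have hN : 1 ≤ N := (hc.q_pos K).trans_le hKN
  have h1 := hc.abs_sum_truncatedReciprocal_sub_le hN hNK hS1 hS
  have h2 := truncatedReciprocalSum_split (α := α) hN hcS
  have h3 := hc.mul_card_dist_lt_le hKN hNK hS1 hAS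
  have h9 : (0 : ℝ) ≤ N := Nat.cast_nonneg N
  have h6 : (q (K + 1) : ℝ) - (3 + 36 / c) * N ≤
      ∑ n ∈ Finset.Icc 1 N with (c / N ≤ distNearestInt ((n : ℕ) * α) ∧
        distNearestInt (n * α) < S / N), 1 / distNearestInt (n * α) := by
    by_cases hbig : 2 ≤ A (K + 1) ∧ 36 ≤ c * A (K + 1)
    · have := hc.le_sum_multiples hKN hNK hc0 hAS hbig.1 hbig.2 hN4
      have : 0 ≤ (3 + 36 / c) * N := by positivity
      linarith
    -- For `A (K + 1)` bounded in terms of `c`, `q (K + 1)` is itself `O(N)` and the middle sum may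
    -- be dropped.
    · have hA : (A (K + 1) : ℝ) ≤ 2 + 36 / c := by
        have h36 : 0 ≤ 36 / c := by positivity
        rw [not_and_or, not_le, not_le] at hbig
        rcases hbig with h | h
        · have : (A (K + 1) : ℝ) < 2 := by exact_mod_cast h
          linarith
        · have : (A (K + 1) : ℝ) < 36 / c := by
            rw [lt_div_iff₀ hc0]
            linarith
          linarith
      have hq : (q (K + 1) : ℝ) ≤ (A (K + 1) + 1) * q K := by exact_mod_cast hc.q_succ_le K
      have hqN : (q K : ℝ) ≤ N := by exact_mod_cast hKN
      have hle : (q (K + 1) : ℝ) ≤ (3 + 36 / c) * N :=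
        hq.trans (mul_le_mul (by linarith) hqN (Nat.cast_nonneg _) (by positivity))
      have : 0 ≤ ∑ n ∈ Finset.Icc 1 N with (c / N ≤ distNearestInt ((n : ℕ) * α) ∧
          distNearestInt (n * α) < S / N), 1 / distNearestInt (n * α) :=
        Finset.sum_nonneg fun _ _ => one_div_nonneg.2 (distNearestInt_nonneg _)
      linarith
  rw [abs_le] at h1
  linarith

end IsConvergentData

lemma one_le_errorLog (x : ℝ) : 1 ≤ errorLog x := by
  rw [errorLog, Real.le_log_iff_exp_le (lt_max_of_lt_left (Real.exp_pos 1))]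
  exact le_max_left _ _

lemma log_le_errorLog {x : ℝ} (hx : 0 < x) : Real.log x ≤ errorLog x :=
  Real.log_le_log hx (le_max_right _ _)

theorem theorem3 (c : ℝ) (hc : 0 < c) :
    ∃ C : ℝ, ∀ (α : ℝ), Irrational α → ∀ (K N : ℕ),
      convergentDenom α K ≤ (N : ℝ) → (N : ℝ) < convergentDenom α (K + 1) →
        |truncatedReciprocalSum c α N - 2 * (N : ℝ) * Real.log (N : ℝ)| ≤
            C * ((Real.sqrt (partialQuotient α (K + 1)) +
              errorLog (partialQuotientSum α (K + 1))) * (N : ℝ)) ∧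
        (4 * Real.sqrt (c * partialQuotient α (K + 1)) * convergentDenom α K ≤ (N : ℝ) →
          2 * (N : ℝ) * Real.log (N : ℝ) + convergentDenom α (K + 1)
              - C * (errorLog (partialQuotientSum α (K + 1)) * (N : ℝ)) ≤
            truncatedReciprocalSum c α N) := by
  obtain ⟨C, hC⟩ : ∃ C : ℝ, C = 74 + 36 / c + 18 * Real.log (1 + c) + 32 * Real.sqrt (1 / c) :=
    ⟨_, rfl⟩
  refine ⟨C, fun α hα K N hKN hNK => ?_⟩
  obtain ⟨p, q, A, hd, hq, hA⟩ := exists_convergentData hα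
  have hs : partialQuotientSum α (K + 1) = ∑ i ∈ Finset.Icc 1 (K + 1), (A i : ℝ) := by
    refine Finset.sum_congr rfl fun i hi => ?_
    obtain ⟨j, rfl⟩ := Nat.exists_eq_add_of_le' (Finset.mem_Icc.1 hi).1
    exact hA j
  rw [hq] at hKN hNK ⊢
  rw [hq, hA, hs]
  replace hKN : q K ≤ N := by exact_mod_cast hKN
  replace hNK : N < q (K + 1) := by exact_mod_cast hNK
  obtain ⟨s, hs'⟩ : ∃ s : ℝ, s = ∑ i ∈ Finset.Icc 1 (K + 1), (A i : ℝ) := ⟨_, rfl⟩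
  have hAs : (A (K + 1) : ℝ) ≤ s := by
    rw [hs']
    exact Finset.single_le_sum (f := fun i => (A i : ℝ)) (fun i _ => Nat.cast_nonneg _)
      (Finset.mem_Icc.2 ⟨by omega, le_rfl⟩)
  have hA1 : (1 : ℝ) ≤ A (K + 1) := by exact_mod_cast hd.one_le_A K
  have hs1 : 1 ≤ s := hA1.trans hAs
  have hsS : s ≤ (1 + c) * s := by nlinarith
  have hlogS : Real.log ((1 + c) * s) ≤ Real.log (1 + c) + errorLog s := by
    rw [Real.log_mul (by positivity) (by positivity)]
    have := log_le_errorLog (show 0 < s by linarith)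
    linarith
  have hE := one_le_errorLog s
  have hlc : 0 ≤ Real.log (1 + c) := Real.log_nonneg (by linarith)
  have hlE : Real.log (1 + c) ≤ Real.log (1 + c) * errorLog s := le_mul_of_one_le_right hlc hE
  have h36 : 0 ≤ 36 / c := by positivity
  have h36E : 36 / c ≤ 36 / c * errorLog s := le_mul_of_one_le_right h36 hE
  have hr0 : 0 ≤ Real.sqrt (1 / c) := Real.sqrt_nonneg _
  have ha0 : 0 ≤ Real.sqrt (A (K + 1)) := Real.sqrt_nonneg _
  have hN0 : (0 : ℝ) ≤ N := Nat.cast_nonneg N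
  have hrE := mul_nonneg hr0 (zero_le_one.trans hE)
  rw [← hs']
  constructor
  -- `S = (1 + c) * s` dominates `1`, `c` and `s` at once, and its logarithm exceeds `errorLog s` by
  -- at most `log (1 + c)`.
  · refine (hd.abs_truncatedReciprocalSum_sub_le hKN hNK hc (S := (1 + c) * s) (hs1.trans hsS)
      (by nlinarith) (hs' ▸ hsS) (hAs.trans hsS)).trans ?_
    rw [← mul_assoc]
    refine mul_le_mul_of_nonneg_right ?_ hN0
    have h1 : 32 * Real.sqrt (1 / c) * Real.sqrt (A (K + 1)) ≤ C * Real.sqrt (A (K + 1)) := by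
      refine mul_le_mul_of_nonneg_right ?_ ha0
      linarith
    have h2 : 56 + 18 * Real.log ((1 + c) * s) ≤ C * errorLog s := by
      rw [hC]
      linarith
    linarith
  · intro hN4
    refine le_trans ?_ (hd.le_truncatedReciprocalSum hKN hNK hc (S := (1 + c) * s) (hs1.trans hsS)
      (by nlinarith) (hs' ▸ hsS) (hAs.trans hsS) hN4)
    have h2 : 27 + 36 / c + 2 * Real.log ((1 + c) * s) ≤ C * errorLog s := by
      rw [hC]
      linarith
    have := mul_le_mul_of_nonneg_right h2 hN0
    linarith
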